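/- Let $n\in\mathbb N$ and $0<\gamma<\alpha<\tfrac12$. For each $i\in\mathbb N$ let $\Sigma_i$ be a closed (compact, boundaryless) smooth surface and $F_i:\Sigma_i\to\mathbb R^n$ a smooth embedding, with induced metric $g_i=dF_i\otimes dF_i$, induced area measure $\mu_{g_i}$ and mean curvature vector $\vec H_i$ (the full trace $g_i^{jk}A_{jk}$ of the second fundamental form, so that a round sphere of radius $R$ has $|\vec H|=2/R$). For $p\in\Sigma_i$ and $r>0$ write $B_r(p)=F_i^{-1}(B_r(F_i(p)))\subset\Sigma_i$, where $B_r(x)\subset\mathbb R^n$ is the open Euclidean ball. Assume that $$\int_{\Sigma_i}|\vec H_i|^2\,d\mu_{g_i}\le 32\pi(1-\alpha)\qquad\text{for all } i,$$ and that the Willmore energy does not concentrate, uniformly along the sequence: $$\lim_{r\to0}\ \limsup_{i\to\infty}\ \sup_{p\in\Sigma_i}\int_{B_r(p)}|\vec H_i|^2\,d\mu_{g_i}=0 .$$ Then there is $a>0$ such that $r^D_\gamma(\Sigma_i)\ge a$ for all sufficiently large $i$. Here, for $x\in F_i(\Sigma_i)$, $$r^D_\gamma(x)=\sup\Big\{b>0:\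 \frac{\mu_{g_i}(F_i^{-1}(B_r(x)))}{\pi r^2}\le 2(1-\gamma)\ \text{ for all } 0<r\le b\Big\}\in[0,\infty]$$ (with $\sup\emptyset=0$), and $r^D_\gamma(\Sigma_i)=\inf_{x\in F_i(\Sigma_i)}r^D_\gamma(x)$ is the $\gamma$ non-concentration radius. -/

import Mathlib

open MeasureTheory Set Filter Topology Manifold
open scoped ENNReal ContDiff

noncomputable section

/-- The `i`-th coordinate vector of `ℝ²`. -/
def coordVec (i : Fin 2) : EuclideanSpace ℝ (Fin 2) := EuclideanSpace.single i 1

/-- First fundamental form `g_{ij} = ⟨∂_i f, ∂_j f⟩` of a parametrization `f : ℝ² → ℝⁿ`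
at the parameter `x`. -/
def firstFundamentalForm {n : ℕ} (f : EuclideanSpace ℝ (Fin 2) → EuclideanSpace ℝ (Fin n))
    (x : EuclideanSpace ℝ (Fin 2)) : Matrix (Fin 2) (Fin 2) ℝ :=
  Matrix.of fun i j => inner ℝ (fderiv ℝ f x (coordVec i)) (fderiv ℝ f x (coordVec j))

/-- Second fundamental form `A_{ij} = (∂_i ∂_j f)^⊥` of a parametrization: the component of the
second derivative orthogonal to the tangent plane `range (df_x)`. -/
def secondFundamentalForm {n : ℕ} (f : EuclideanSpace ℝ (Fin 2) → EuclideanSpace ℝ (Fin n))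
    (x : EuclideanSpace ℝ (Fin 2)) (i j : Fin 2) : EuclideanSpace ℝ (Fin n) :=
  ((LinearMap.range (fderiv ℝ f x).toLinearMap)ᗮ).starProjection
    (fderiv ℝ (fderiv ℝ f) x (coordVec i) (coordVec j))

/-- Mean curvature vector `g^{ij} A_{ij}` of a parametrization: the full trace, so that a round
sphere of radius `R` has mean curvature of length `2 / R`. -/
def paramMeanCurvature {n : ℕ} (f : EuclideanSpace ℝ (Fin 2) → EuclideanSpace ℝ (Fin n))
    (x : EuclideanSpace ℝ (Fin 2)) : EuclideanSpace ℝ (Fin n) :=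
  ∑ i, ∑ j, (firstFundamentalForm f x)⁻¹ i j • secondFundamentalForm f x i j

section Surface

variable {n : ℕ} {M : Type*} [TopologicalSpace M] [ChartedSpace (EuclideanSpace ℝ (Fin 2)) M]

/-- Mean curvature vector of an immersed surface `F : M → ℝⁿ` at `p`, computed in the preferred
chart at `p` (its value does not depend on the chart). -/
def meanCurvatureVector (F : M → EuclideanSpace ℝ (Fin n)) (p : M) : EuclideanSpace ℝ (Fin n) :=
  paramMeanCurvature (F ∘ (chartAt (EuclideanSpace ℝ (Fin 2)) p).symm)
    (chartAt (EuclideanSpace ℝ (Fin 2)) p p)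

variable [MeasurableSpace M]

/-- Area measure of the metric induced by `F` on the domain of the chart `e`: the image under
`e⁻¹` of `√(det g_{ij}) dx` on the target of `e`. -/
def chartAreaMeasure (F : M → EuclideanSpace ℝ (Fin n))
    (e : OpenPartialHomeomorph M (EuclideanSpace ℝ (Fin 2))) : Measure M :=
  (((volume : Measure (EuclideanSpace ℝ (Fin 2))).restrict e.target).withDensity
    fun x => ENNReal.ofReal (√(firstFundamentalForm (F ∘ e.symm) x).det)).map e.symm

/-- Area measure `μ_g` of the metric `g = dF ⊗ dF` induced by `F : M → ℝⁿ`. The measures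
`chartAreaMeasure F e` agree on overlaps of charts, and their supremum in the lattice of
measures is the measure obtained by gluing them. -/
def areaMeasure (F : M → EuclideanSpace ℝ (Fin n)) : Measure M :=
  ⨆ e ∈ atlas (EuclideanSpace ℝ (Fin 2)) M, chartAreaMeasure F e

/-- `∫_S |H|² dμ_g`, as an extended nonnegative real. -/
def willmoreEnergyOn (F : M → EuclideanSpace ℝ (Fin n)) (S : Set M) : ℝ≥0∞ :=
  ∫⁻ q in S, ‖meanCurvatureVector F q‖ₑ ^ 2 ∂(areaMeasure F)

/-- The `γ` non-concentration radius at `x`: the supremum of all `a > 0` such that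
`μ_g (F⁻¹ (B_r(x))) / (π r²) ≤ 2 (1 - γ)` for all `0 < r ≤ a`. It may be infinite, and it is `0`
if there is no such `a`. -/
def nonConcentrationRadiusAt (γ : ℝ) (F : M → EuclideanSpace ℝ (Fin n))
    (x : EuclideanSpace ℝ (Fin n)) : ℝ≥0∞ :=
  sSup (ENNReal.ofReal '' {a : ℝ | 0 < a ∧ ∀ r : ℝ, 0 < r → r ≤ a →
    areaMeasure F (F ⁻¹' Metric.ball x r) / ENNReal.ofReal (Real.pi * r ^ 2)
      ≤ ENNReal.ofReal (2 * (1 - γ))})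

/-- The `γ` non-concentration radius of the surface: the infimum over the points of its image. -/
def nonConcentrationRadius (γ : ℝ) (F : M → EuclideanSpace ℝ (Fin n)) : ℝ≥0∞ :=
  ⨅ x ∈ range F, nonConcentrationRadiusAt γ F x

end Surface

end

/-! ### Gram matrices and traces of parametrizations -/

/-! This is a localized Li–Yau estimate. By the first variation formula, `div Y + ⟨Y, H⟩` integrates
to zero on a closed surface. Take `Y = v/ψ(|v|²)` with `v = F - x₀`, where `ψ` is a C¹ version of
`max(|v|², r²)`. Far from `x₀` the integrand is `2|v^⊥|²/|v|⁴ + ⟨v^⊥, H⟩/|v|²`, at least `-|H|²/8`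
by completing the square. On `B_r` it is `2/ψ + ⟨v, H⟩/ψ`, and Young's inequality bounds the last
term at the price of a small part of `2/ψ` and `|H|²/(4η)`. Hence, if `(1+η)r² ≤ R²`, `(2-η) μ(B_r)
≤ (1+η) r² (W/8 + (1/(4η)) ∫_{B_R} |H|²)`, which is `measureReal_preimage_ball_le`. Since `W/8 ≤
4π(1-α)`, the area ratio is at most about `2(1-α)`, and the gap between `γ` and `α` absorbs the
errors once the energy in `B_R` is small. Non-concentration supplies one such `R` for all points and
all large `i`, so `a = R/2` works. The first variation formula rests on `sum_fderiv_conormalField`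
(the Laplacian of the position is `H`), invariance under change of chart, the gluing of the chart
measures in `areaMeasure_restrict_source`, and a partition of unity. -/

/-- Area density `√(det g)` of a parametrization. -/
noncomputable def areaDensity {n : ℕ} (f : EuclideanSpace ℝ (Fin 2) → EuclideanSpace ℝ (Fin n))
    (x : EuclideanSpace ℝ (Fin 2)) : ℝ :=
  √(firstFundamentalForm f x).det

/-- Divergence along the surface `g^{ij} ⟨∂_i y, ∂_j f⟩` of a vector field `y` along `f`. -/
noncomputable def paramDivergence {n : ℕ}
    (f y : EuclideanSpace ℝ (Fin 2) → EuclideanSpace ℝ (Fin n))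
    (x : EuclideanSpace ℝ (Fin 2)) : ℝ :=
  ∑ i, ∑ j, (firstFundamentalForm f x)⁻¹ i j *
    inner ℝ (fderiv ℝ y x (coordVec i)) (fderiv ℝ f x (coordVec j))

/-- The tangent field `√(det g) g^{ij} ∂_j f`. -/
noncomputable def conormalField {n : ℕ}
    (f : EuclideanSpace ℝ (Fin 2) → EuclideanSpace ℝ (Fin n)) (i : Fin 2)
    (x : EuclideanSpace ℝ (Fin 2)) : EuclideanSpace ℝ (Fin n) :=
  areaDensity f x • ∑ j, (firstFundamentalForm f x)⁻¹ i j • fderiv ℝ f x (coordVec j)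

section Param

variable {n : ℕ} {f : EuclideanSpace ℝ (Fin 2) → EuclideanSpace ℝ (Fin n)}
  {x : EuclideanSpace ℝ (Fin 2)}

lemma eq_sum_coordVec (v : EuclideanSpace ℝ (Fin 2)) : v = ∑ i, v i • coordVec i := by
  ext i
  fin_cases i <;> simp [coordVec]

lemma det_firstFundamentalForm_pos (hf : Function.Injective (fderiv ℝ f x)) :
    0 < (firstFundamentalForm f x).det := by
  have hli : LinearIndependent ℝ (fun i => fderiv ℝ f x (coordVec i)) := by
    have h0 : LinearIndependent ℝ coordVec := by
      have hc : coordVec = ⇑(EuclideanSpace.basisFun (Fin 2) ℝ).toBasis := by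
        ext i
        simp [coordVec]
      rw [hc]
      exact (EuclideanSpace.basisFun (Fin 2) ℝ).toBasis.linearIndependent
    exact h0.map' (fderiv ℝ f x).toLinearMap (LinearMap.ker_eq_bot.2 hf)
  exact (Matrix.posDef_gram_of_linearIndependent (𝕜 := ℝ) hli).det_pos

lemma areaDensity_pos (hf : Function.Injective (fderiv ℝ f x)) : 0 < areaDensity f x :=
  Real.sqrt_pos.2 (det_firstFundamentalForm_pos hf)

lemma firstFundamentalForm_comm (i j : Fin 2) :
    firstFundamentalForm f x i j = firstFundamentalForm f x j i := by
  simp [firstFundamentalForm, real_inner_comm]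

lemma det_firstFundamentalForm :
    (firstFundamentalForm f x).det = firstFundamentalForm f x 0 0 * firstFundamentalForm f x 1 1 -
      firstFundamentalForm f x 0 1 * firstFundamentalForm f x 0 1 := by
  rw [Matrix.det_fin_two, firstFundamentalForm_comm 1 0]

lemma inv_firstFundamentalForm :
    (firstFundamentalForm f x)⁻¹ = (firstFundamentalForm f x).det⁻¹ •
      !![firstFundamentalForm f x 1 1, -firstFundamentalForm f x 0 1;
        -firstFundamentalForm f x 0 1, firstFundamentalForm f x 0 0] := by
  rw [Matrix.inv_def, Ring.inverse_eq_inv', Matrix.adjugate_fin_two, firstFundamentalForm_comm 1 0]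

/-- Since `det g` is the square of the area density, the inverse matrix disappears and a form that
is easy to differentiate remains. -/
lemma conormalField_zero (hf : Function.Injective (fderiv ℝ f x)) :
    conormalField f 0 x = (areaDensity f x)⁻¹ •
      (firstFundamentalForm f x 1 1 • fderiv ℝ f x (coordVec 0) -
        firstFundamentalForm f x 0 1 • fderiv ℝ f x (coordVec 1)) := by
  have hd : (firstFundamentalForm f x).det = areaDensity f x ^ 2 :=
    (Real.sq_sqrt (det_firstFundamentalForm_pos hf).le).symm
  have := (areaDensity_pos hf).ne'
  simp only [conormalField, inv_firstFundamentalForm, Fin.sum_univ_two, hd]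
  simp only [Matrix.smul_apply, Matrix.of_apply, Matrix.cons_val', Matrix.cons_val_zero,
    Matrix.cons_val_one, Matrix.cons_val_fin_one, smul_eq_mul, smul_add, smul_sub, smul_smul]
  rw [sub_eq_add_neg, ← neg_smul]
  congr 2 <;> field_simp

lemma conormalField_one (hf : Function.Injective (fderiv ℝ f x)) :
    conormalField f 1 x = (areaDensity f x)⁻¹ •
      (firstFundamentalForm f x 0 0 • fderiv ℝ f x (coordVec 1) -
        firstFundamentalForm f x 0 1 • fderiv ℝ f x (coordVec 0)) := by
  have hd : (firstFundamentalForm f x).det = areaDensity f x ^ 2 :=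
    (Real.sq_sqrt (det_firstFundamentalForm_pos hf).le).symm
  have := (areaDensity_pos hf).ne'
  simp only [conormalField, inv_firstFundamentalForm, Fin.sum_univ_two, hd]
  simp only [Matrix.smul_apply, Matrix.of_apply, Matrix.cons_val', Matrix.cons_val_zero,
    Matrix.cons_val_one, Matrix.cons_val_fin_one, smul_eq_mul, smul_add, smul_sub, smul_smul]
  rw [sub_eq_add_neg, ← neg_smul, add_comm]
  congr 2 <;> field_simp

/-- The vector `g^{ij} ⟨v, ∂_i f⟩ ∂_j f` and its scalar product with `v`. -/
lemma exists_tangential_part (hf : Function.Injective (fderiv ℝ f x))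
    (v : EuclideanSpace ℝ (Fin n)) :
    ∃ τ ∈ LinearMap.range (fderiv ℝ f x).toLinearMap,
      inner ℝ v τ = ∑ i, ∑ j, (firstFundamentalForm f x)⁻¹ i j *
        (inner ℝ (fderiv ℝ f x (coordVec i)) v * inner ℝ (fderiv ℝ f x (coordVec j)) v) ∧
      inner ℝ τ τ = inner ℝ v τ := by
  have hd := (det_firstFundamentalForm_pos hf).ne'
  -- The witness is the orthogonal projection of `v` to the tangent plane, written in coordinates.
  refine ⟨∑ i, ∑ j, ((firstFundamentalForm f x)⁻¹ i j * inner ℝ (fderiv ℝ f x (coordVec i)) v) •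
    fderiv ℝ f x (coordVec j), ?_, ?_, ?_⟩
  · exact Submodule.sum_mem _ fun i _ => Submodule.sum_mem _ fun j _ =>
      Submodule.smul_mem _ _ ⟨coordVec j, rfl⟩
  · simp [Fin.sum_univ_two, inner_add_right, inner_smul_right, real_inner_comm v, mul_assoc]
  · rw [det_firstFundamentalForm] at hd
    simp only [inv_firstFundamentalForm, det_firstFundamentalForm, Fin.sum_univ_two,
      Matrix.smul_apply, Matrix.of_apply, Matrix.cons_val', Matrix.cons_val_zero,
      Matrix.cons_val_one, Matrix.cons_val_fin_one, smul_eq_mul, inner_add_left, inner_add_right,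
      real_inner_smul_left, real_inner_smul_right, real_inner_comm v]
    have h10 : inner ℝ (fderiv ℝ f x (coordVec 1)) (fderiv ℝ f x (coordVec 0)) =
      firstFundamentalForm f x 0 1 := real_inner_comm _ _
    have hij : ∀ i j, inner ℝ (fderiv ℝ f x (coordVec i)) (fderiv ℝ f x (coordVec j)) =
      firstFundamentalForm f x i j := fun _ _ => rfl
    rw [h10, hij, hij, hij]
    generalize firstFundamentalForm f x 0 0 = E at *
    generalize firstFundamentalForm f x 0 1 = G at *
    generalize firstFundamentalForm f x 1 1 = H at *
    obtain ⟨D, hD⟩ : ∃ D, D = E * H - G * G := ⟨_, rfl⟩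
    rw [← hD] at hd ⊢
    field_simp
    rw [hD]
    ring

lemma inner_paramMeanCurvature_eq_zero {τ : EuclideanSpace ℝ (Fin n)}
    (hτ : τ ∈ LinearMap.range (fderiv ℝ f x).toLinearMap) :
    inner ℝ τ (paramMeanCurvature f x) = 0 := by
  simp only [paramMeanCurvature, inner_sum, inner_smul_right]
  refine Finset.sum_eq_zero fun i _ => Finset.sum_eq_zero fun j _ => ?_
  rw [secondFundamentalForm, Submodule.inner_right_of_mem_orthogonal hτ (Submodule.starProjection_apply_mem _ _),
    mul_zero]

lemma starProjection_fderiv_apply (v : EuclideanSpace ℝ (Fin 2)) :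
    ((LinearMap.range (fderiv ℝ f x).toLinearMap)ᗮ).starProjection (fderiv ℝ f x v) = 0 := by
  rw [Submodule.starProjection_apply_eq_zero_iff]
  exact Submodule.le_orthogonal_orthogonal _ ⟨v, rfl⟩

end Param

/-! ### Change of parameters -/

/-- The trace of a bilinear form with respect to a metric does not depend on the basis. Values in a
module `W` cover both the divergence (scalar) and the mean curvature (vector). -/
lemma sum_inv_smul_congr {W : Type*} [AddCommGroup W] [Module ℝ W]
    (g T : Matrix (Fin 2) (Fin 2) ℝ) (hT : IsUnit T.det) (b : Fin 2 → Fin 2 → W) :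
    ∑ i, ∑ j, (T.transpose * g * T)⁻¹ i j • ∑ k, ∑ l, (T k i * T l j) • b k l =
      ∑ k, ∑ l, g⁻¹ k l • b k l := by
  have h : T * (T.transpose * g * T)⁻¹ * T.transpose = g⁻¹ := by
    rw [Matrix.mul_inv_rev, Matrix.mul_inv_rev, ← Matrix.mul_assoc, Matrix.mul_nonsing_inv _ hT,
      Matrix.one_mul, Matrix.mul_assoc, Matrix.nonsing_inv_mul _ (by simpa using hT),
      Matrix.mul_one]
  have hkl : ∀ k l, g⁻¹ k l = ∑ i, ∑ j, (T.transpose * g * T)⁻¹ i j * (T k i * T l j) := by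
    intro k l
    rw [← h]
    simp only [Matrix.mul_apply (M := T * _), Matrix.mul_apply (M := T), Matrix.transpose_apply,
      Fin.sum_univ_two]
    ring
  simp only [hkl, Fin.sum_univ_two, smul_add, add_smul, smul_smul]
  abel

section Change

variable {n : ℕ} {f : EuclideanSpace ℝ (Fin 2) → EuclideanSpace ℝ (Fin n)}
  {τ : EuclideanSpace ℝ (Fin 2) → EuclideanSpace ℝ (Fin 2)} {x : EuclideanSpace ℝ (Fin 2)}

/-- Jacobian matrix of a change of parameters. -/
noncomputable def jacobianMatrix (τ : EuclideanSpace ℝ (Fin 2) → EuclideanSpace ℝ (Fin 2))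
    (x : EuclideanSpace ℝ (Fin 2)) : Matrix (Fin 2) (Fin 2) ℝ :=
  Matrix.of fun k i => fderiv ℝ τ x (coordVec i) k

lemma det_jacobianMatrix : (jacobianMatrix τ x).det = (fderiv ℝ τ x).det := by
  have h : jacobianMatrix τ x = LinearMap.toMatrix (EuclideanSpace.basisFun (Fin 2) ℝ).toBasis
      (EuclideanSpace.basisFun (Fin 2) ℝ).toBasis (fderiv ℝ τ x).toLinearMap := by
    ext i j
    simp [jacobianMatrix, LinearMap.toMatrix_apply, coordVec]
  rw [h, LinearMap.det_toMatrix]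

lemma fderiv_comp_coordVec {W : Type*} [NormedAddCommGroup W] [NormedSpace ℝ W]
    {f : EuclideanSpace ℝ (Fin 2) → W}
    (hf : DifferentiableAt ℝ f (τ x)) (hτ : DifferentiableAt ℝ τ x) (i : Fin 2) :
    fderiv ℝ (f ∘ τ) x (coordVec i) =
      ∑ k, jacobianMatrix τ x k i • fderiv ℝ f (τ x) (coordVec k) := by
  rw [fderiv_comp x hf hτ, ContinuousLinearMap.comp_apply,
    eq_sum_coordVec (fderiv ℝ τ x (coordVec i))]
  simp [jacobianMatrix]

lemma firstFundamentalForm_comp (hf : DifferentiableAt ℝ f (τ x)) (hτ : DifferentiableAt ℝ τ x) :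
    firstFundamentalForm (f ∘ τ) x =
      (jacobianMatrix τ x).transpose * firstFundamentalForm f (τ x) * jacobianMatrix τ x := by
  ext i j
  simp only [firstFundamentalForm, Matrix.of_apply, fderiv_comp_coordVec hf hτ, Matrix.mul_apply,
    Matrix.transpose_apply, Fin.sum_univ_two, inner_add_left, inner_add_right,
    real_inner_smul_left, real_inner_smul_right]
  ring

lemma areaDensity_comp (hf : DifferentiableAt ℝ f (τ x)) (hτ : DifferentiableAt ℝ τ x) :
    areaDensity (f ∘ τ) x = |(fderiv ℝ τ x).det| * areaDensity f (τ x) := by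
  rw [areaDensity, areaDensity, firstFundamentalForm_comp hf hτ, Matrix.det_mul, Matrix.det_mul,
    Matrix.det_transpose, det_jacobianMatrix, ← Real.sqrt_sq_eq_abs,
    ← Real.sqrt_mul (sq_nonneg _)]
  ring_nf

lemma paramDivergence_comp {y : EuclideanSpace ℝ (Fin 2) → EuclideanSpace ℝ (Fin n)}
    (hf : DifferentiableAt ℝ f (τ x)) (hy : DifferentiableAt ℝ y (τ x))
    (hτ : DifferentiableAt ℝ τ x) (hdet : (fderiv ℝ τ x).det ≠ 0) :
    paramDivergence (f ∘ τ) (y ∘ τ) x = paramDivergence f y (τ x) := by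
  rw [paramDivergence, firstFundamentalForm_comp hf hτ, paramDivergence]
  rw [← det_jacobianMatrix] at hdet
  have := sum_inv_smul_congr (firstFundamentalForm f (τ x)) (jacobianMatrix τ x) hdet.isUnit
    fun k l => inner ℝ (fderiv ℝ y (τ x) (coordVec k)) (fderiv ℝ f (τ x) (coordVec l))
  simp only [smul_eq_mul] at this
  rw [← this]
  refine Finset.sum_congr rfl fun i _ => Finset.sum_congr rfl fun j _ => ?_
  congr 1
  simp only [fderiv_comp_coordVec hf hτ, fderiv_comp_coordVec hy hτ, Fin.sum_univ_two,
    inner_add_left, inner_add_right, real_inner_smul_left, real_inner_smul_right]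
  ring

/-- The chain rule for second derivatives produces an extra term `df(D²τ)`. It is tangent, so the
normal projection removes it. The tangent plane itself is unchanged because `dτ` is invertible. -/
lemma secondFundamentalForm_comp (hf : ContDiffAt ℝ 2 f (τ x)) (hτ : ContDiffAt ℝ 2 τ x)
    (hdet : (fderiv ℝ τ x).det ≠ 0) (i j : Fin 2) :
    secondFundamentalForm (f ∘ τ) x i j =
      ∑ k, ∑ l, (jacobianMatrix τ x k i * jacobianMatrix τ x l j) •
        secondFundamentalForm f (τ x) k l := by
  have hf1 := hf.differentiableAt (by norm_num)
  have hτ1 := hτ.differentiableAt (by norm_num)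
  have hf2 : DifferentiableAt ℝ (fderiv ℝ f) (τ x) :=
    (hf.fderiv_right (m := 1) (by norm_num)).differentiableAt (by norm_num)
  have hτ2 : DifferentiableAt ℝ (fderiv ℝ τ) x :=
    (hτ.fderiv_right (m := 1) (by norm_num)).differentiableAt (by norm_num)
  have hev : fderiv ℝ (f ∘ τ) =ᶠ[𝓝 x] fun z => (fderiv ℝ f (τ z)).comp (fderiv ℝ τ z) := by
    filter_upwards [hτ.eventually (by norm_num), hτ.continuousAt.eventually
      (hf.eventually (by norm_num))] with z hz hz'
    exact fderiv_comp z (hz'.differentiableAt (by norm_num)) (hz.differentiableAt (by norm_num))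
  have hsnd : ∀ u v, fderiv ℝ (fderiv ℝ (f ∘ τ)) x u v =
      fderiv ℝ f (τ x) (fderiv ℝ (fderiv ℝ τ) x u v) +
        fderiv ℝ (fderiv ℝ f) (τ x) (fderiv ℝ τ x u) (fderiv ℝ τ x v) := by
    intro u v
    rw [hev.fderiv_eq]
    have h1 : HasFDerivAt (fun z => fderiv ℝ f (τ z))
        ((fderiv ℝ (fderiv ℝ f) (τ x)).comp (fderiv ℝ τ x)) x :=
      hf2.hasFDerivAt.comp x hτ1.hasFDerivAt
    rw [(h1.clm_comp hτ2.hasFDerivAt).fderiv]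
    simp
  have hrange : LinearMap.range (fderiv ℝ (f ∘ τ) x).toLinearMap =
      LinearMap.range (fderiv ℝ f (τ x)).toLinearMap := by
    rw [fderiv_comp x hf1 hτ1, ContinuousLinearMap.toLinearMap_comp]
    refine LinearMap.range_comp_of_range_eq_top _ ?_
    exact (LinearEquiv.ofIsUnitDet (f := (fderiv ℝ τ x).toLinearMap)
      (v := (EuclideanSpace.basisFun (Fin 2) ℝ).toBasis)
      (v' := (EuclideanSpace.basisFun (Fin 2) ℝ).toBasis)
      (by rw [LinearMap.det_toMatrix]; exact hdet.isUnit)).range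
  simp only [secondFundamentalForm, hrange]
  rw [hsnd, map_add, starProjection_fderiv_apply, zero_add,
    eq_sum_coordVec (fderiv ℝ τ x (coordVec i)), eq_sum_coordVec (fderiv ℝ τ x (coordVec j))]
  simp only [jacobianMatrix, Matrix.of_apply, Fin.sum_univ_two, map_add, map_smul,
    add_apply, smul_apply]
  module

lemma paramMeanCurvature_comp (hf : ContDiffAt ℝ 2 f (τ x)) (hτ : ContDiffAt ℝ 2 τ x)
    (hdet : (fderiv ℝ τ x).det ≠ 0) :
    paramMeanCurvature (f ∘ τ) x = paramMeanCurvature f (τ x) := by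
  simp only [paramMeanCurvature, secondFundamentalForm_comp hf hτ hdet]
  rw [firstFundamentalForm_comp (hf.differentiableAt (by norm_num))
    (hτ.differentiableAt (by norm_num))]
  rw [← det_jacobianMatrix] at hdet
  exact sum_inv_smul_congr _ _ hdet.isUnit _

end Change

/-! ### The divergence theorem in a parameter domain -/

section Domain

variable {n : ℕ} {f : EuclideanSpace ℝ (Fin 2) → EuclideanSpace ℝ (Fin n)}
  {U : Set (EuclideanSpace ℝ (Fin 2))}

lemma contDiffOn_fderiv_apply (hU : IsOpen U) (hf : ContDiffOn ℝ ∞ f U)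
    (v : EuclideanSpace ℝ (Fin 2)) : ContDiffOn ℝ ∞ (fun x => fderiv ℝ f x v) U :=
  (hf.fderiv_of_isOpen hU (by simp)).clm_apply contDiffOn_const

lemma contDiffOn_firstFundamentalForm (hU : IsOpen U) (hf : ContDiffOn ℝ ∞ f U) (i j : Fin 2) :
    ContDiffOn ℝ ∞ (fun x => firstFundamentalForm f x i j) U :=
  (contDiffOn_fderiv_apply hU hf _).inner ℝ (contDiffOn_fderiv_apply hU hf _)

lemma contDiffOn_det_firstFundamentalForm (hU : IsOpen U) (hf : ContDiffOn ℝ ∞ f U) :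
    ContDiffOn ℝ ∞ (fun x => (firstFundamentalForm f x).det) U := by
  simp only [det_firstFundamentalForm]
  have := contDiffOn_firstFundamentalForm hU hf
  exact ((this 0 0).mul (this 1 1)).sub ((this 0 1).mul (this 0 1))

lemma contDiffOn_areaDensity (hU : IsOpen U) (hf : ContDiffOn ℝ ∞ f U)
    (hinj : ∀ x ∈ U, Function.Injective (fderiv ℝ f x)) : ContDiffOn ℝ ∞ (areaDensity f) U :=
  (contDiffOn_det_firstFundamentalForm hU hf).sqrt fun x hx =>
    (det_firstFundamentalForm_pos (hinj x hx)).ne'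

lemma contDiffOn_conormalField (hU : IsOpen U) (hf : ContDiffOn ℝ ∞ f U)
    (hinj : ∀ x ∈ U, Function.Injective (fderiv ℝ f x)) (i : Fin 2) :
    ContDiffOn ℝ ∞ (conormalField f i) U := by
  have hg := contDiffOn_firstFundamentalForm hU hf
  have hu := contDiffOn_fderiv_apply hU hf
  have hJ := (contDiffOn_areaDensity hU hf hinj).inv fun x hx => (areaDensity_pos (hinj x hx)).ne'
  fin_cases i
  · exact (hJ.smul (((hg 1 1).smul (hu (coordVec 0))).sub ((hg 0 1).smul (hu (coordVec 1))))).congr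
      fun x hx => conormalField_zero (hinj x hx)
  · exact (hJ.smul (((hg 0 0).smul (hu (coordVec 1))).sub ((hg 0 1).smul (hu (coordVec 0))))).congr
      fun x hx => conormalField_one (hinj x hx)

/-- The Laplacian of the position vector is the mean curvature vector. -/
lemma sum_fderiv_conormalField (hU : IsOpen U) (hf : ContDiffOn ℝ ∞ f U)
    (hinj : ∀ x ∈ U, Function.Injective (fderiv ℝ f x)) {x : EuclideanSpace ℝ (Fin 2)}
    (hx : x ∈ U) :
    ∑ i, fderiv ℝ (conormalField f i) x (coordVec i) =
      areaDensity f x • paramMeanCurvature f x := by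
  have hUx := hU.mem_nhds hx
  have hfx : ContDiffAt ℝ ∞ f x := hf.contDiffAt hUx
  have hf2 : HasFDerivAt (fderiv ℝ f) (fderiv ℝ (fderiv ℝ f) x) x :=
    ((hfx.fderiv_right (m := 1) (by norm_cast)).differentiableAt (by norm_num)).hasFDerivAt
  have hsymm : IsSymmSndFDerivAt ℝ f x := hfx.isSymmSndFDerivAt (by simp; norm_cast)
  have hd0 := det_firstFundamentalForm_pos (hinj x hx)
  have hJ0 := areaDensity_pos (hinj x hx)
  have hu : ∀ j, HasFDerivAt (fun z => fderiv ℝ f z (coordVec j))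
      ((fderiv ℝ (fderiv ℝ f) x).flip (coordVec j)) x := by
    intro j
    refine (hf2.clm_apply (hasFDerivAt_const (coordVec j) x)).congr_fderiv ?_
    ext v
    simp
  have hg : ∀ i j, ∃ g' : EuclideanSpace ℝ (Fin 2) →L[ℝ] ℝ,
      HasFDerivAt (fun z => firstFundamentalForm f z i j) g' x ∧ ∀ v, g' v =
      inner ℝ (fderiv ℝ f x (coordVec i)) (fderiv ℝ (fderiv ℝ f) x v (coordVec j)) +
      inner ℝ (fderiv ℝ (fderiv ℝ f) x v (coordVec i)) (fderiv ℝ f x (coordVec j)) := by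
    intro i j
    refine ⟨_, (hu i).inner ℝ (hu j), fun v => ?_⟩
    simp
  obtain ⟨E', hE, hE'⟩ := hg 0 0
  obtain ⟨F', hF, hF'⟩ := hg 0 1
  obtain ⟨G', hG, hG'⟩ := hg 1 1
  -- Derivative of `(det g)^(-1/2)`, with `det g = EG - F²`.
  obtain ⟨k', hk, hk'⟩ : ∃ k' : EuclideanSpace ℝ (Fin 2) →L[ℝ] ℝ,
      HasFDerivAt (fun z => (areaDensity f z)⁻¹) k' x ∧
      ∀ v, k' v = -((areaDensity f x)⁻¹ ^ 3 / 2) *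
        (firstFundamentalForm f x 0 0 * G' v + firstFundamentalForm f x 1 1 * E' v -
          2 * firstFundamentalForm f x 0 1 * F' v) := by
    have hD := ((hE.mul hG).sub (hF.mul hF))
    have hJ : HasFDerivAt (areaDensity f) _ x :=
      HasFDerivAt.sqrt (f := fun z => (firstFundamentalForm f z).det)
        (hD.congr_of_eventuallyEq (Eventually.of_forall fun z => det_firstFundamentalForm)) hd0.ne'
    refine ⟨_, (hasDerivAt_inv hJ0.ne').comp_hasFDerivAt x hJ, fun v => ?_⟩
    change _ * (1 / (2 * areaDensity f x) * _) = _
    simp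
    field_simp
    ring
  have hV0 : HasFDerivAt (conormalField f 0) _ x :=
    (hk.smul ((hG.smul (hu 0)).sub (hF.smul (hu 1)))).congr_of_eventuallyEq
      (by filter_upwards [hUx] with z hz using conormalField_zero (hinj z hz))
  have hV1 : HasFDerivAt (conormalField f 1) _ x :=
    (hk.smul ((hE.smul (hu 1)).sub (hF.smul (hu 0)))).congr_of_eventuallyEq
      (by filter_upwards [hUx] with z hz using conormalField_one (hinj z hz))
  have h01 := hsymm (coordVec 0) (coordVec 1)
  set S := ∑ i, fderiv ℝ (conormalField f i) x (coordVec i) with hS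
  rw [Fin.sum_univ_two, hV0.fderiv, hV1.fderiv] at hS
  simp only [add_apply, sub_apply, smul_apply, ContinuousLinearMap.smulRight_apply,
    ContinuousLinearMap.flip_apply, Pi.sub_apply, Pi.smul_apply'] at hS
  have hJk : (areaDensity f x)⁻¹ ^ 2 * (firstFundamentalForm f x 0 0 * firstFundamentalForm f x 1 1 -
      firstFundamentalForm f x 0 1 * firstFundamentalForm f x 0 1) = 1 := by
    rw [← det_firstFundamentalForm, ← Real.sq_sqrt hd0.le, inv_pow]
    exact inv_mul_cancel₀ (pow_ne_zero 2 hJ0.ne')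
  -- The divergence `S` is normal: its product with each `∂_j f` is a multiple of `1 - J⁻² det g`,
  -- where `J` is the area density, once mixed partials are identified.
  have hS0 : ∀ j, inner ℝ (fderiv ℝ f x (coordVec j)) S = 0 := by
    have hij : ∀ i j, inner ℝ (fderiv ℝ f x (coordVec i)) (fderiv ℝ f x (coordVec j)) =
      firstFundamentalForm f x i j := fun _ _ => rfl
    intro j
    rw [hS]
    simp only [inner_add_right, inner_sub_right, inner_smul_right, hk', hE', hF', hG', h01, hij,
      real_inner_comm (fderiv ℝ f x (coordVec 0)) (fderiv ℝ (fderiv ℝ f) x _ _),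
      real_inner_comm (fderiv ℝ f x (coordVec 1)) (fderiv ℝ (fderiv ℝ f) x _ _)]
    generalize (areaDensity f x)⁻¹ = k at hJk ⊢
    fin_cases j
    · change k * (_ * inner ℝ (fderiv ℝ f x (coordVec 0)) _ + _ * firstFundamentalForm f x 0 0 -
        (_ * inner ℝ (fderiv ℝ f x (coordVec 0)) _ + _ * firstFundamentalForm f x 0 1)) +
        _ * (_ * firstFundamentalForm f x 0 0 - _ * firstFundamentalForm f x 0 1) +
        (k * (_ * inner ℝ (fderiv ℝ f x (coordVec 0)) _ + _ * firstFundamentalForm f x 0 1 -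
        (_ * inner ℝ (fderiv ℝ f x (coordVec 0)) _ + _ * firstFundamentalForm f x 0 0)) +
        _ * (_ * firstFundamentalForm f x 0 1 - _ * firstFundamentalForm f x 0 0)) = 0
      generalize fderiv ℝ (fderiv ℝ f) x = B
      linear_combination (-k * (firstFundamentalForm f x 1 1 *
          inner ℝ (fderiv ℝ f x (coordVec 0)) (B (coordVec 0) (coordVec 0))
        + firstFundamentalForm f x 0 0 *
          inner ℝ (fderiv ℝ f x (coordVec 1)) (B (coordVec 1) (coordVec 0))
        - firstFundamentalForm f x 0 1 *
          inner ℝ (fderiv ℝ f x (coordVec 0)) (B (coordVec 1) (coordVec 0))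
        - firstFundamentalForm f x 0 1 *
          inner ℝ (fderiv ℝ f x (coordVec 1)) (B (coordVec 0) (coordVec 0)))) * hJk
    · change k * (_ * inner ℝ (fderiv ℝ f x (coordVec 1)) _ + _ * firstFundamentalForm f x 1 0 -
        (_ * inner ℝ (fderiv ℝ f x (coordVec 1)) _ + _ * firstFundamentalForm f x 1 1)) +
        _ * (_ * firstFundamentalForm f x 1 0 - _ * firstFundamentalForm f x 1 1) +
        (k * (_ * inner ℝ (fderiv ℝ f x (coordVec 1)) _ + _ * firstFundamentalForm f x 1 1 -
        (_ * inner ℝ (fderiv ℝ f x (coordVec 1)) _ + _ * firstFundamentalForm f x 1 0)) +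
        _ * (_ * firstFundamentalForm f x 1 1 - _ * firstFundamentalForm f x 1 0)) = 0
      generalize fderiv ℝ (fderiv ℝ f) x = B
      rw [firstFundamentalForm_comm 1 0]
      linear_combination (-k * (firstFundamentalForm f x 0 0 *
          inner ℝ (fderiv ℝ f x (coordVec 1)) (B (coordVec 1) (coordVec 1))
        + firstFundamentalForm f x 1 1 *
          inner ℝ (fderiv ℝ f x (coordVec 0)) (B (coordVec 1) (coordVec 0))
        - firstFundamentalForm f x 0 1 *
          inner ℝ (fderiv ℝ f x (coordVec 1)) (B (coordVec 1) (coordVec 0))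
        - firstFundamentalForm f x 0 1 *
          inner ℝ (fderiv ℝ f x (coordVec 0)) (B (coordVec 1) (coordVec 1)))) * hJk
  have hSmem : S ∈ (LinearMap.range (fderiv ℝ f x).toLinearMap)ᗮ := by
    rw [Submodule.mem_orthogonal]
    rintro _ ⟨v, rfl⟩
    rw [eq_sum_coordVec v, map_sum, sum_inner]
    exact Finset.sum_eq_zero fun i _ => by
      rw [map_smul, real_inner_smul_left]
      exact mul_eq_zero_of_right _ (hS0 i)
  -- Being normal, `S` equals its normal projection. The projection kills every term in which a
  -- scalar coefficient is differentiated, and only the trace of the second fundamental form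
  -- survives.
  have hPS := Submodule.starProjection_eq_self_iff.2 hSmem
  rw [← hPS, hS]
  simp only [map_add, map_sub, map_smul, starProjection_fderiv_apply, paramMeanCurvature,
    secondFundamentalForm, inv_firstFundamentalForm, Fin.sum_univ_two]
  have hd : (firstFundamentalForm f x).det⁻¹ = (areaDensity f x)⁻¹ * (areaDensity f x)⁻¹ := by
    rw [← mul_inv, areaDensity, Real.mul_self_sqrt hd0.le]
  rw [h01, hd]
  simp only [Matrix.smul_apply, Matrix.of_apply, Matrix.cons_val', Matrix.cons_val_zero,
    Matrix.cons_val_one, Matrix.cons_val_fin_one, smul_eq_mul, smul_zero, add_zero, sub_zero,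
    smul_add, smul_smul, mul_assoc, mul_inv_cancel_left₀ hJ0.ne']
  module

end Domain

section Domain

variable {n : ℕ} {f : EuclideanSpace ℝ (Fin 2) → EuclideanSpace ℝ (Fin n)}
  {U : Set (EuclideanSpace ℝ (Fin 2))}

/-- Product rule: differentiating the conormal field gives the mean curvature term, differentiating
`y` gives the divergence. The first variation integrand is thus a Euclidean divergence. -/
lemma sum_fderiv_inner_conormalField (hU : IsOpen U) (hf : ContDiffOn ℝ ∞ f U)
    (hinj : ∀ x ∈ U, Function.Injective (fderiv ℝ f x)) {x : EuclideanSpace ℝ (Fin 2)}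
    (hx : x ∈ U) {y : EuclideanSpace ℝ (Fin 2) → EuclideanSpace ℝ (Fin n)}
    (hy : DifferentiableAt ℝ y x) :
    ∑ i, fderiv ℝ (fun z => inner ℝ (y z) (conormalField f i z)) x (coordVec i) =
      areaDensity f x * (paramDivergence f y x + inner ℝ (y x) (paramMeanCurvature f x)) := by
  have hV : ∀ i, DifferentiableAt ℝ (conormalField f i) x := fun i =>
    ((contDiffOn_conormalField hU hf hinj i).contDiffAt (hU.mem_nhds hx)).differentiableAt
      (by simp)
  have h : ∀ i, fderiv ℝ (fun z => inner ℝ (y z) (conormalField f i z)) x (coordVec i) =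
      inner ℝ (y x) (fderiv ℝ (conormalField f i) x (coordVec i)) +
        inner ℝ (fderiv ℝ y x (coordVec i)) (conormalField f i x) :=
    fun i => fderiv_inner_apply ℝ hy (hV i) _
  simp only [h, Finset.sum_add_distrib]
  rw [← inner_sum, sum_fderiv_conormalField hU hf hinj hx, real_inner_smul_right, mul_add, add_comm]
  congr 1
  simp only [conormalField, paramDivergence, inner_sum, real_inner_smul_right, Finset.mul_sum]

/-- Extended by zero outside `U`, the function is C¹ with compact support on the whole plane, so
integration by parts against the constant `1` applies. -/
lemma setIntegral_fderiv_eq_zero (hU : IsOpen U) {w : EuclideanSpace ℝ (Fin 2) → ℝ}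
    (hw : ContDiffOn ℝ 1 w U) {K : Set (EuclideanSpace ℝ (Fin 2))} (hK : IsCompact K)
    (hKU : K ⊆ U) (hwK : ∀ x ∈ U, x ∉ K → w x = 0) (v : EuclideanSpace ℝ (Fin 2)) :
    IntegrableOn (fun x => fderiv ℝ w x v) U ∧ ∫ x in U, fderiv ℝ w x v = 0 := by
  set u := U.indicator w with hu
  have hu0 : ∀ x, x ∉ K → u x = 0 := by
    intro x hx
    by_cases hxU : x ∈ U
    · rw [hu, indicator_of_mem hxU, hwK x hxU hx]
    · rw [hu, indicator_of_notMem hxU]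
  have huU : ∀ x ∈ U, u =ᶠ[𝓝 x] w := fun x hx => by
    filter_upwards [hU.mem_nhds hx] with z hz using indicator_of_mem hz _
  have hucd : ContDiff ℝ 1 u := by
    rw [contDiff_iff_contDiffAt]
    intro x
    by_cases hxU : x ∈ U
    · exact (hw.contDiffAt (hU.mem_nhds hxU)).congr_of_eventuallyEq (huU x hxU)
    · refine (contDiffAt_const (c := (0 : ℝ))).congr_of_eventuallyEq ?_
      filter_upwards [hK.isClosed.isOpen_compl.mem_nhds fun h => hxU (hKU h)] with z hz
        using hu0 z hz
  have hcs : HasCompactSupport u := HasCompactSupport.intro hK fun x hx => hu0 x hx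
  have hcs' : HasCompactSupport fun x => fderiv ℝ u x v :=
    (hcs.fderiv ℝ).comp_left (g := fun L : EuclideanSpace ℝ (Fin 2) →L[ℝ] ℝ => L v) rfl
  have hcont : Continuous fun x => fderiv ℝ u x v :=
    (hucd.continuous_fderiv (by norm_num)).clm_apply continuous_const
  have hint : Integrable fun x => fderiv ℝ u x v := hcont.integrable_of_hasCompactSupport hcs'
  have hzero : ∫ x, fderiv ℝ u x v = 0 := by
    have := integral_mul_fderiv_eq_neg_fderiv_mul_of_integrable (μ := volume)
      (f := fun _ : EuclideanSpace ℝ (Fin 2) => (1 : ℝ)) (g := u) (v := v)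
      (by simp) (by simpa using hint)
      (by simpa using hucd.continuous.integrable_of_hasCompactSupport hcs)
      (by simp) (fun x _ => hucd.differentiable (by norm_num) x)
    simpa using this
  have hEq : EqOn (fun x => fderiv ℝ u x v) (fun x => fderiv ℝ w x v) U := fun x hx => by
    simp only [(huU x hx).fderiv_eq]
  refine ⟨hint.integrableOn.congr_fun hEq hU.measurableSet, ?_⟩
  rw [← setIntegral_congr_fun hU.measurableSet hEq, ← hzero]
  refine setIntegral_eq_integral_of_forall_compl_eq_zero fun x hx => ?_
  have : u =ᶠ[𝓝 x] fun _ => (0 : ℝ) := by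
    filter_upwards [hK.isClosed.isOpen_compl.mem_nhds fun h => hx (hKU h)] with z hz
      using hu0 z hz
  rw [this.fderiv_eq]
  simp

/-- The first variation formula for vector fields supported in a parameter domain. -/
lemma setIntegral_divergence_add_inner_eq_zero (hU : IsOpen U) (hf : ContDiffOn ℝ ∞ f U)
    (hinj : ∀ x ∈ U, Function.Injective (fderiv ℝ f x))
    {y : EuclideanSpace ℝ (Fin 2) → EuclideanSpace ℝ (Fin n)} (hy : ContDiffOn ℝ 1 y U)
    {K : Set (EuclideanSpace ℝ (Fin 2))} (hK : IsCompact K)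
    (hKU : K ⊆ U) (hyK : ∀ x ∈ U, x ∉ K → y x = 0) :
    ∫ x in U, areaDensity f x *
      (paramDivergence f y x + inner ℝ (y x) (paramMeanCurvature f x)) = 0 := by
  have hw : ∀ i, ContDiffOn ℝ 1 (fun z => inner ℝ (y z) (conormalField f i z)) U := fun i =>
    hy.inner ℝ ((contDiffOn_conormalField hU hf hinj i).of_le (by norm_cast))
  have h := fun i => setIntegral_fderiv_eq_zero hU (hw i) hK hKU
    (fun x hx hxK => by rw [hyK x hx hxK, inner_zero_left]) (coordVec i)
  rw [← setIntegral_congr_fun hU.measurableSet fun x hx =>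
    sum_fderiv_inner_conormalField hU hf hinj hx
      ((hy.contDiffAt (hU.mem_nhds hx)).differentiableAt (by norm_num)),
    integral_finsetSum _ fun i _ => (h i).1]
  exact Finset.sum_eq_zero fun i _ => (h i).2

/-- Read off from the divergence formula for `H`, so that the dependence of the normal projection on
the point need not be studied. -/
lemma continuousOn_paramMeanCurvature (hU : IsOpen U) (hf : ContDiffOn ℝ ∞ f U)
    (hinj : ∀ x ∈ U, Function.Injective (fderiv ℝ f x)) :
    ContinuousOn (paramMeanCurvature f) U := by
  have hJ := (contDiffOn_areaDensity hU hf hinj).continuousOn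
  have hV : ∀ i, ContinuousOn (fun x => fderiv ℝ (conormalField f i) x (coordVec i)) U := fun i =>
    (((contDiffOn_conormalField hU hf hinj i).fderiv_of_isOpen hU
      (m := 0) (by simp)).continuousOn).clm_apply continuousOn_const
  refine ((hJ.inv₀ fun x hx => (areaDensity_pos (hinj x hx)).ne').smul
    (continuousOn_finsetSum Finset.univ fun i _ => hV i)).congr fun x hx => ?_
  change _ = (areaDensity f x)⁻¹ • ∑ i, fderiv ℝ (conormalField f i) x (coordVec i)
  rw [sum_fderiv_conormalField hU hf hinj hx, smul_smul,
    inv_mul_cancel₀ (areaDensity_pos (hinj x hx)).ne', one_smul]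

lemma continuousOn_paramDivergence (hU : IsOpen U) (hf : ContDiffOn ℝ ∞ f U)
    (hinj : ∀ x ∈ U, Function.Injective (fderiv ℝ f x))
    {y : EuclideanSpace ℝ (Fin 2) → EuclideanSpace ℝ (Fin n)} (hy : ContDiffOn ℝ 1 y U) :
    ContinuousOn (paramDivergence f y) U := by
  have hJ := (contDiffOn_areaDensity hU hf hinj).continuousOn
  have hV : ∀ i, ContinuousOn (fun x => inner ℝ (fderiv ℝ y x (coordVec i))
      (conormalField f i x)) U := fun i =>
    (((hy.fderiv_of_isOpen hU (m := 0) (by simp)).continuousOn).clm_apply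
      continuousOn_const).inner (contDiffOn_conormalField hU hf hinj i).continuousOn
  refine ((hJ.inv₀ fun x hx => (areaDensity_pos (hinj x hx)).ne').mul
    (continuousOn_finsetSum Finset.univ fun i _ => hV i)).congr fun x hx => ?_
  have := (areaDensity_pos (hinj x hx)).ne'
  change _ = (areaDensity f x)⁻¹ *
    ∑ i, inner ℝ (fderiv ℝ y x (coordVec i)) (conormalField f i x)
  simp only [conormalField, paramDivergence, inner_sum, real_inner_smul_right, Finset.mul_sum,
    inv_mul_cancel_left₀ this]

end Domain

/-! ### Charts of an immersed surface -/

section Germ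

variable {n : ℕ} {f f' y y' : EuclideanSpace ℝ (Fin 2) → EuclideanSpace ℝ (Fin n)}
  {x : EuclideanSpace ℝ (Fin 2)}

lemma firstFundamentalForm_congr (h : f =ᶠ[𝓝 x] f') :
    firstFundamentalForm f x = firstFundamentalForm f' x := by
  simp only [firstFundamentalForm, h.fderiv_eq]

lemma areaDensity_congr (h : f =ᶠ[𝓝 x] f') : areaDensity f x = areaDensity f' x := by
  simp only [areaDensity, firstFundamentalForm_congr h]

lemma paramDivergence_congr (h : f =ᶠ[𝓝 x] f') (hy : y =ᶠ[𝓝 x] y') :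
    paramDivergence f y x = paramDivergence f' y' x := by
  simp only [paramDivergence, firstFundamentalForm_congr h, h.fderiv_eq, hy.fderiv_eq]

lemma paramMeanCurvature_congr (h : f =ᶠ[𝓝 x] f') :
    paramMeanCurvature f x = paramMeanCurvature f' x := by
  simp only [paramMeanCurvature, secondFundamentalForm, firstFundamentalForm_congr h, h.fderiv_eq,
    h.fderiv.fderiv_eq]

end Germ

section Chart

variable {n : ℕ} {M : Type*} [TopologicalSpace M] {F Y : M → EuclideanSpace ℝ (Fin n)}
  {e e' : OpenPartialHomeomorph M (EuclideanSpace ℝ (Fin 2))} {x : EuclideanSpace ℝ (Fin 2)}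

/-- Two chart expressions of a map are related only on the overlap, hence only as germs; this is why
the preceding congruences are stated for germs. -/
lemma comp_symm_eventuallyEq {W : Type*} (G : M → W) (hx : x ∈ e'.target)
    (hx' : e'.symm x ∈ e.source) :
    G ∘ e'.symm =ᶠ[𝓝 x] (G ∘ e.symm) ∘ (e ∘ e'.symm) := by
  filter_upwards [(e'.symm.continuousAt hx).preimage_mem_nhds (e.open_source.mem_nhds hx')]
    with z hz
  simp [e.left_inv hz]

variable [ChartedSpace (EuclideanSpace ℝ (Fin 2)) M]

lemma contDiffOn_comp_symm {W : Type*} [NormedAddCommGroup W] [NormedSpace ℝ W] {G : M → W}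
    {m : ℕ∞} (hG : ContMDiff (𝓡 2) 𝓘(ℝ, W) m G)
    (he : e ∈ IsManifold.maximalAtlas (𝓡 2) ∞ M) : ContDiffOn ℝ m (G ∘ e.symm) e.target := by
  rw [← contMDiffOn_iff_contDiffOn]
  exact hG.comp_contMDiffOn ((contMDiffOn_symm_of_mem_maximalAtlas he).of_le
    (by exact_mod_cast le_top))

lemma contDiffAt_transition (he : e ∈ IsManifold.maximalAtlas (𝓡 2) ∞ M)
    (he' : e' ∈ IsManifold.maximalAtlas (𝓡 2) ∞ M) (hx : x ∈ e'.target)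
    (hx' : e'.symm x ∈ e.source) : ContDiffAt ℝ ∞ (e ∘ e'.symm) x := by
  rw [← contMDiffAt_iff_contDiffAt]
  exact (contMDiffAt_of_mem_maximalAtlas he hx').comp x
    (contMDiffAt_symm_of_mem_maximalAtlas he' hx)

/-- Composing with the reverse transition gives the identity near `x`; take determinants in the
chain rule. -/
lemma det_fderiv_transition_ne_zero (he : e ∈ IsManifold.maximalAtlas (𝓡 2) ∞ M)
    (he' : e' ∈ IsManifold.maximalAtlas (𝓡 2) ∞ M) (hx : x ∈ e'.target)
    (hx' : e'.symm x ∈ e.source) : (fderiv ℝ (e ∘ e'.symm) x).det ≠ 0 := by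
  have h1 := (contDiffAt_transition he he' hx hx').differentiableAt (by simp)
  have h2 : DifferentiableAt ℝ (e' ∘ e.symm) ((e ∘ e'.symm) x) :=
    (contDiffAt_transition he' he (e.map_source hx')
      (by simpa [e.left_inv hx'] using e'.map_target hx)).differentiableAt (by simp)
  have hid : (e' ∘ e.symm) ∘ (e ∘ e'.symm) =ᶠ[𝓝 x] id := by
    filter_upwards [(comp_symm_eventuallyEq e' hx hx').symm, e'.open_target.mem_nhds hx]
      with z hz hz'
    rw [hz]
    exact e'.right_inv hz'
  have h := hid.fderiv_eq (𝕜 := ℝ)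
  rw [fderiv_comp x h2 h1, fderiv_id] at h
  intro h0
  have hdet := congrArg (fun L : EuclideanSpace ℝ (Fin 2) →L[ℝ] EuclideanSpace ℝ (Fin 2) => L.det) h
  rw [ContinuousLinearMap.det, ContinuousLinearMap.toLinearMap_comp, LinearMap.det_comp] at hdet
  rw [ContinuousLinearMap.det] at h0
  rw [h0, mul_zero] at hdet
  simp [ContinuousLinearMap.det] at hdet

lemma injective_fderiv_transition (he : e ∈ IsManifold.maximalAtlas (𝓡 2) ∞ M)
    (he' : e' ∈ IsManifold.maximalAtlas (𝓡 2) ∞ M) (hx : x ∈ e'.target)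
    (hx' : e'.symm x ∈ e.source) : Function.Injective (fderiv ℝ (e ∘ e'.symm) x) := by
  have h := det_fderiv_transition_ne_zero he he' hx hx'
  exact (LinearMap.equivOfDetNeZero (fderiv ℝ (e ∘ e'.symm) x).toLinearMap h).injective

/-- An immersion is given by its local normal form `u ↦ (u, 0)` in suitable charts. The differential
of `F`, followed by that of the codomain chart, is this injective linear map after an invertible
transition, so it is injective itself. -/
lemma injective_fderiv_comp_symm (hF : IsImmersion (𝓡 2) (𝓡 n) ∞ F)
    (he : e ∈ IsManifold.maximalAtlas (𝓡 2) ∞ M) (hx : x ∈ e.target) :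
    Function.Injective (fderiv ℝ (F ∘ e.symm) x) := by
  have h := hF.isImmersionAt (e.symm x)
  have hd := h.domChart_mem_maximalAtlas
  have hc := h.codChart_mem_maximalAtlas
  have hpd := h.mem_domChart_source
  have hpc := h.mem_codChart_source
  have hw := h.writtenInCharts
  set d := h.domChart
  set c := h.codChart
  have hFd : DifferentiableAt ℝ (F ∘ e.symm) x :=
    ((contDiffOn_comp_symm (m := ⊤) hF.contMDiff he).contDiffAt
      (e.open_target.mem_nhds hx)).differentiableAt (by simp)
  have hcd : DifferentiableAt ℝ c (F (e.symm x)) :=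
    ContDiffAt.differentiableAt (n := ∞) (contMDiffAt_iff_contDiffAt.1
      (contMDiffAt_of_mem_maximalAtlas hc hpc)) (by simp)
  have hτ := (contDiffAt_transition hd he hx hpd).differentiableAt (by simp)
  have hev : c ∘ (F ∘ e.symm) =ᶠ[𝓝 x] (fun v => h.equiv (v, 0)) ∘ (d ∘ e.symm) := by
    filter_upwards [(e.symm.continuousAt hx).preimage_mem_nhds (d.open_source.mem_nhds hpd)]
      with z hz
    have := hw (x := d (e.symm z)) (by simpa using d.map_source hz)
    simpa [d.left_inv hz] using this
  let L : EuclideanSpace ℝ (Fin 2) →L[ℝ] EuclideanSpace ℝ (Fin n) :=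
    (h.equiv : (EuclideanSpace ℝ (Fin 2) × h.complement) →L[ℝ] EuclideanSpace ℝ (Fin n)).comp
      (ContinuousLinearMap.inl ℝ _ _)
  have hL : Function.Injective L := fun a b hab => by
    simpa [L] using hab
  have hfd := hev.fderiv_eq (𝕜 := ℝ)
  rw [fderiv_comp x hcd hFd, show (fun v => h.equiv (v, 0)) = L from rfl,
    fderiv_comp x L.differentiableAt hτ, L.fderiv] at hfd
  have hinj : Function.Injective ((fderiv ℝ c ((F ∘ e.symm) x)).comp (fderiv ℝ (F ∘ e.symm) x)) := by
    rw [hfd]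
    exact hL.comp (injective_fderiv_transition hd he hx hpd)
  exact Function.Injective.of_comp hinj

variable [IsManifold (𝓡 2) ∞ M]

/-- Divergence along the surface of a vector field along `F`, in the preferred chart. -/
noncomputable def surfaceDivergence (F Y : M → EuclideanSpace ℝ (Fin n)) (p : M) : ℝ :=
  paramDivergence (F ∘ (chartAt (EuclideanSpace ℝ (Fin 2)) p).symm)
    (Y ∘ (chartAt (EuclideanSpace ℝ (Fin 2)) p).symm) (chartAt (EuclideanSpace ℝ (Fin 2)) p p)

/-- The preferred chart changes with the point. Continuity and integration need one fixed chart on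
an open set. -/
lemma meanCurvatureVector_eq (hF : ContMDiff (𝓡 2) (𝓡 n) ∞ F)
    (he : e ∈ IsManifold.maximalAtlas (𝓡 2) ∞ M) {p : M} (hp : p ∈ e.source) :
    meanCurvatureVector F p = paramMeanCurvature (F ∘ e.symm) (e p) := by
  set c := chartAt (EuclideanSpace ℝ (Fin 2)) p
  have hc : c ∈ IsManifold.maximalAtlas (𝓡 2) ∞ M := IsManifold.chart_mem_maximalAtlas p
  have hpc : p ∈ c.source := mem_chart_source _ p
  have hx : c p ∈ c.target := c.map_source hpc
  have hx' : c.symm (c p) ∈ e.source := by rwa [c.left_inv hpc]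
  have hτp : (e ∘ c.symm) (c p) = e p := by simp [c.left_inv hpc]
  rw [meanCurvatureVector, paramMeanCurvature_congr (comp_symm_eventuallyEq F hx hx'),
    paramMeanCurvature_comp, hτp]
  · rw [hτp]
    exact ((contDiffOn_comp_symm (m := ⊤) hF he).contDiffAt
      (e.open_target.mem_nhds (e.map_source hp))).of_le (by norm_cast)
  · exact (contDiffAt_transition he hc hx hx').of_le (by norm_cast)
  · exact det_fderiv_transition_ne_zero he hc hx hx'

lemma surfaceDivergence_eq (hF : ContMDiff (𝓡 2) (𝓡 n) ∞ F) (hY : ContMDiff (𝓡 2) (𝓡 n) 1 Y)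
    (he : e ∈ IsManifold.maximalAtlas (𝓡 2) ∞ M) {p : M} (hp : p ∈ e.source) :
    surfaceDivergence F Y p = paramDivergence (F ∘ e.symm) (Y ∘ e.symm) (e p) := by
  set c := chartAt (EuclideanSpace ℝ (Fin 2)) p
  have hc : c ∈ IsManifold.maximalAtlas (𝓡 2) ∞ M := IsManifold.chart_mem_maximalAtlas p
  have hpc : p ∈ c.source := mem_chart_source _ p
  have hx : c p ∈ c.target := c.map_source hpc
  have hx' : c.symm (c p) ∈ e.source := by rwa [c.left_inv hpc]
  have hτp : (e ∘ c.symm) (c p) = e p := by simp [c.left_inv hpc]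
  have hep := e.open_target.mem_nhds (e.map_source hp)
  rw [surfaceDivergence, paramDivergence_congr (comp_symm_eventuallyEq F hx hx')
    (comp_symm_eventuallyEq Y hx hx'), paramDivergence_comp, hτp]
  · rw [hτp]
    exact ((contDiffOn_comp_symm (m := ⊤) hF he).contDiffAt hep).differentiableAt (by simp)
  · rw [hτp]
    exact ((contDiffOn_comp_symm (m := 1) hY he).contDiffAt hep).differentiableAt (by simp)
  · exact (contDiffAt_transition he hc hx hx').differentiableAt (by simp)
  · exact det_fderiv_transition_ne_zero he hc hx hx'

lemma continuous_meanCurvatureVector (hF : IsImmersion (𝓡 2) (𝓡 n) ∞ F) :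
    Continuous (meanCurvatureVector F) := by
  rw [continuous_iff_continuousAt]
  intro p
  set c := chartAt (EuclideanSpace ℝ (Fin 2)) p
  have hc : c ∈ IsManifold.maximalAtlas (𝓡 2) ∞ M := IsManifold.chart_mem_maximalAtlas p
  have hpc : p ∈ c.source := mem_chart_source _ p
  have h := (continuousOn_paramMeanCurvature c.open_target
    (contDiffOn_comp_symm (m := ⊤) hF.contMDiff hc)
    fun x hx => injective_fderiv_comp_symm hF hc hx).continuousAt
      (c.open_target.mem_nhds (c.map_source hpc))
  refine (h.comp (c.continuousAt hpc)).congr ?_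
  filter_upwards [c.open_source.mem_nhds hpc] with q hq
  exact (meanCurvatureVector_eq hF.contMDiff hc hq).symm

lemma continuous_surfaceDivergence (hF : IsImmersion (𝓡 2) (𝓡 n) ∞ F)
    (hY : ContMDiff (𝓡 2) (𝓡 n) 1 Y) : Continuous (surfaceDivergence F Y) := by
  rw [continuous_iff_continuousAt]
  intro p
  set c := chartAt (EuclideanSpace ℝ (Fin 2)) p
  have hc : c ∈ IsManifold.maximalAtlas (𝓡 2) ∞ M := IsManifold.chart_mem_maximalAtlas p
  have hpc : p ∈ c.source := mem_chart_source _ p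
  have h := (continuousOn_paramDivergence c.open_target
    (contDiffOn_comp_symm (m := ⊤) hF.contMDiff hc)
    (fun x hx => injective_fderiv_comp_symm hF hc hx)
    (contDiffOn_comp_symm (m := 1) hY hc)).continuousAt
      (c.open_target.mem_nhds (c.map_source hpc))
  refine (h.comp (c.continuousAt hpc)).congr ?_
  filter_upwards [c.open_source.mem_nhds hpc] with q hq
  exact (surfaceDivergence_eq hF.contMDiff hY hc hq).symm

end Chart

/-! ### The area measure in charts -/

lemma ContinuousOn.measurableSet_inter_preimage {X Z : Type*} [TopologicalSpace X]
    [MeasurableSpace X] [OpensMeasurableSpace X] [TopologicalSpace Z] [MeasurableSpace Z]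
    [BorelSpace Z] {f : X → Z} {s : Set X} (hf : ContinuousOn f s) (hs : MeasurableSet s)
    {A : Set Z} (hA : MeasurableSet A) : MeasurableSet (s ∩ f ⁻¹' A) := by
  have h : Measurable fun x : s => f x := (continuousOn_iff_continuous_domRestrict.1 hf).measurable
  rw [← Subtype.image_preimage_coe]
  exact hs.subtype_image (h hA)

section Area

variable {n : ℕ} {M : Type*} [TopologicalSpace M] [MeasurableSpace M] [BorelSpace M]
  {F : M → EuclideanSpace ℝ (Fin n)}
  {e e' : OpenPartialHomeomorph M (EuclideanSpace ℝ (Fin 2))}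

/-- The inverse chart is controlled only on `e.target`, so measurability holds only almost
everywhere for the restricted measure. Without it `Measure.map` would take its default value `0`. -/
lemma aemeasurable_symm (g : EuclideanSpace ℝ (Fin 2) → ℝ≥0∞) :
    AEMeasurable e.symm (((volume : Measure (EuclideanSpace ℝ (Fin 2))).restrict
      e.target).withDensity g) :=
  (e.continuousOn_symm.aemeasurable e.open_target.measurableSet).mono_ac
    (withDensity_absolutelyContinuous _ _)

lemma chartAreaMeasure_apply {A : Set M} (hA : MeasurableSet A) :
    chartAreaMeasure F e A =
      ∫⁻ x in e.target ∩ e.symm ⁻¹' A, ENNReal.ofReal (areaDensity (F ∘ e.symm) x) := by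
  rw [chartAreaMeasure, Measure.map_apply_of_aemeasurable (aemeasurable_symm _) hA,
    withDensity_apply', Measure.restrict_restrict₀' e.open_target.measurableSet.nullMeasurableSet,
    inter_comm]
  rfl

variable [ChartedSpace (EuclideanSpace ℝ (Fin 2)) M]

/-- Change of variables under the transition map, whose Jacobian is the ratio of the two area
densities. -/
lemma chartAreaMeasure_restrict_le (hF : ContMDiff (𝓡 2) (𝓡 n) ∞ F)
    (he : e ∈ IsManifold.maximalAtlas (𝓡 2) ∞ M) (he' : e' ∈ IsManifold.maximalAtlas (𝓡 2) ∞ M) :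
    (chartAreaMeasure F e').restrict e.source ≤ chartAreaMeasure F e := by
  rw [Measure.le_iff]
  intro A hA
  have hAe := hA.inter e.open_source.measurableSet
  rw [Measure.restrict_apply hA, chartAreaMeasure_apply hAe]
  have hS := e'.continuousOn_symm.measurableSet_inter_preimage e'.open_target.measurableSet hAe
  set S := e'.target ∩ e'.symm ⁻¹' (A ∩ e.source) with hSdef
  have hτ : ∀ x ∈ S, ContDiffAt ℝ ∞ (e ∘ e'.symm) x := fun x hx =>
    contDiffAt_transition he he' hx.1 hx.2.2
  have hinj : InjOn (e ∘ e'.symm) S :=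
    e.injOn.comp (e'.symm.injOn.mono fun x hx => hx.1) fun x hx => hx.2.2
  calc ∫⁻ x in S, ENNReal.ofReal (areaDensity (F ∘ e'.symm) x)
      = ∫⁻ x in S, ENNReal.ofReal |(fderiv ℝ (e ∘ e'.symm) x).det| *
          ENNReal.ofReal (areaDensity (F ∘ e.symm) ((e ∘ e'.symm) x)) := by
        refine setLIntegral_congr_fun hS fun x hx => ?_
        rw [areaDensity_congr (comp_symm_eventuallyEq F hx.1 hx.2.2), areaDensity_comp _
          ((hτ x hx).differentiableAt (by simp)), ENNReal.ofReal_mul (abs_nonneg _)]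
        exact ((contDiffOn_comp_symm (m := ⊤) hF he).contDiffAt
          (e.open_target.mem_nhds (e.map_source hx.2.2))).differentiableAt (by simp)
    _ = ∫⁻ x in (e ∘ e'.symm) '' S, ENNReal.ofReal (areaDensity (F ∘ e.symm) x) :=
        (lintegral_image_eq_lintegral_abs_det_fderiv_mul volume hS (fun x hx =>
          ((hτ x hx).differentiableAt (by simp)).hasFDerivAt.hasFDerivWithinAt) hinj
            fun x => ENNReal.ofReal (areaDensity (F ∘ e.symm) x)).symm
    _ ≤ ∫⁻ x in e.target ∩ e.symm ⁻¹' A, ENNReal.ofReal (areaDensity (F ∘ e.symm) x) := by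
        refine lintegral_mono_set ?_
        rintro _ ⟨x, hx, rfl⟩
        refine ⟨e.map_source hx.2.2, ?_⟩
        simpa [e.left_inv hx.2.2] using hx.2.1
    _ ≤ chartAreaMeasure F e A := (chartAreaMeasure_apply hA).ge

variable [IsManifold (𝓡 2) ∞ M]

lemma areaMeasure_restrict_source (hF : ContMDiff (𝓡 2) (𝓡 n) ∞ F)
    (he : e ∈ atlas (EuclideanSpace ℝ (Fin 2)) M) :
    (areaMeasure F).restrict e.source = chartAreaMeasure F e := by
  have hes := e.open_source.measurableSet
  have hmax := fun e' (h : e' ∈ atlas (EuclideanSpace ℝ (Fin 2)) M) =>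
    IsManifold.subset_maximalAtlas (I := 𝓡 2) (n := ∞) h
  have hle : ∀ e' ∈ atlas (EuclideanSpace ℝ (Fin 2)) M, chartAreaMeasure F e' ≤ areaMeasure F :=
    fun e' h => le_iSup₂ (f := fun e' _ => chartAreaMeasure F e') e' h
  apply le_antisymm
  -- An upper bound for all chart measures at once: split each along `e.source`, compare with `e`
  -- inside and with `areaMeasure F` outside.
  · have hub : areaMeasure F ≤ chartAreaMeasure F e + (areaMeasure F).restrict e.sourceᶜ :=
      iSup₂_le fun e' h => by
        rw [← Measure.restrict_add_restrict_compl (μ := chartAreaMeasure F e') hes]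
        exact add_le_add (chartAreaMeasure_restrict_le hF (hmax e he) (hmax e' h))
          (Measure.restrict_mono le_rfl (hle e' h))
    refine (Measure.restrict_mono le_rfl hub).trans ?_
    rw [Measure.restrict_add, Measure.restrict_restrict hes, inter_compl_self,
      Measure.restrict_empty, add_zero]
    exact Measure.restrict_le_self
  · refine le_of_eq_of_le ?_ (Measure.restrict_mono le_rfl (hle e he))
    ext A hA
    rw [Measure.restrict_apply hA, chartAreaMeasure_apply hA, chartAreaMeasure_apply (hA.inter hes)]
    congr 2
    ext x
    exact ⟨fun h => ⟨h.1, h.2, e.map_target h.1⟩, fun h => ⟨h.1, h.2.1⟩⟩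

lemma setIntegral_source_areaMeasure (hF : ContMDiff (𝓡 2) (𝓡 n) ∞ F)
    (he : e ∈ atlas (EuclideanSpace ℝ (Fin 2)) M) {h : M → ℝ} (hh : Continuous h) :
    ∫ q in e.source, h q ∂(areaMeasure F) =
      ∫ x in e.target, areaDensity (F ∘ e.symm) x * h (e.symm x) := by
  have hJ : AEMeasurable (fun x => ENNReal.ofReal (areaDensity (F ∘ e.symm) x))
      ((volume : Measure (EuclideanSpace ℝ (Fin 2))).restrict e.target) := by
    refine AEMeasurable.ennreal_ofReal ?_
    have hd := contDiffOn_det_firstFundamentalForm e.open_target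
      (contDiffOn_comp_symm (m := ⊤) hF (IsManifold.subset_maximalAtlas he))
    exact hd.continuousOn.sqrt.aemeasurable e.open_target.measurableSet
  rw [areaMeasure_restrict_source hF he, chartAreaMeasure,
    integral_map (aemeasurable_symm _) hh.measurable.aestronglyMeasurable]
  change ∫ x, h (e.symm x) ∂(((volume : Measure (EuclideanSpace ℝ (Fin 2))).restrict
    e.target).withDensity fun x => ENNReal.ofReal (areaDensity (F ∘ e.symm) x)) = _
  rw [integral_withDensity_eq_integral_toReal_smul₀ hJ (by simp)]
  refine integral_congr_ae (Eventually.of_forall fun x => ?_)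
  simp only [smul_eq_mul]
  rw [ENNReal.toReal_ofReal (show 0 ≤ areaDensity _ x from Real.sqrt_nonneg _)]

lemma isLocallyFiniteMeasure_areaMeasure (hF : ContMDiff (𝓡 2) (𝓡 n) ∞ F) :
    IsLocallyFiniteMeasure (areaMeasure F) := by
  refine ⟨fun p => ?_⟩
  set c := chartAt (EuclideanSpace ℝ (Fin 2)) p
  have hc : c ∈ atlas (EuclideanSpace ℝ (Fin 2)) M := chart_mem_atlas _ p
  have hpc : p ∈ c.source := mem_chart_source _ p
  have hd := (contDiffOn_det_firstFundamentalForm c.open_target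
    (contDiffOn_comp_symm (m := ⊤) hF (IsManifold.subset_maximalAtlas hc))).continuousOn.sqrt
  obtain ⟨K, hK, hpK, hKt⟩ := exists_compact_subset c.open_target (c.map_source hpc)
  have hO : IsOpen (c.source ∩ c ⁻¹' interior K) := c.isOpen_inter_preimage isOpen_interior
  refine ⟨_, hO.mem_nhds ⟨hpc, hpK⟩, ?_⟩
  rw [← inter_eq_left.2 (inter_subset_left : c.source ∩ c ⁻¹' interior K ⊆ c.source),
    ← Measure.restrict_apply hO.measurableSet, areaMeasure_restrict_source hF hc,
    chartAreaMeasure_apply hO.measurableSet]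
  have hfin : ∫⁻ x in K, ENNReal.ofReal (areaDensity (F ∘ c.symm) x) < ⊤ :=
    ((hd.mono hKt).integrableOn_compact hK).lintegral_lt_top
  refine (lintegral_mono_set ?_).trans_lt hfin
  rintro x ⟨hx, hx', hx''⟩
  have := interior_subset hx''
  rwa [c.right_inv hx] at this

end Area

/-! ### The first variation formula -/

section FirstVariation

variable {n : ℕ} {M : Type*} [TopologicalSpace M] [ChartedSpace (EuclideanSpace ℝ (Fin 2)) M]
  {F Y : M → EuclideanSpace ℝ (Fin n)}

lemma surfaceDivergence_eq_zero_of_notMem_tsupport {p : M} (hp : p ∉ tsupport Y) :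
    surfaceDivergence F Y p = 0 := by
  set c := chartAt (EuclideanSpace ℝ (Fin 2)) p with hcdef
  have hpc : p ∈ c.source := mem_chart_source _ p
  have h0 : Y ∘ c.symm =ᶠ[𝓝 (c p)] fun _ => 0 := by
    have hY := notMem_tsupport_iff_eventuallyEq.1 hp
    have hc := c.continuousAt_symm (c.map_source hpc)
    rw [ContinuousAt, c.left_inv hpc] at hc
    exact hc.eventually hY
  rw [surfaceDivergence, ← hcdef, paramDivergence, h0.fderiv_eq]
  simp

variable [IsManifold (𝓡 2) ∞ M]

lemma surfaceDivergence_sum {ι : Type*} (s : Finset ι) {Z : ι → M → EuclideanSpace ℝ (Fin n)}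
    (hZ : ∀ i ∈ s, ContMDiff (𝓡 2) (𝓡 n) 1 (Z i)) (p : M) :
    surfaceDivergence F (fun q => ∑ i ∈ s, Z i q) p = ∑ i ∈ s, surfaceDivergence F (Z i) p := by
  set c := chartAt (EuclideanSpace ℝ (Fin 2)) p with hcdef
  have hd : ∀ i ∈ s, DifferentiableAt ℝ (Z i ∘ c.symm) (c p) := fun i hi =>
    ((contDiffOn_comp_symm (m := 1) (hZ i hi) (IsManifold.chart_mem_maximalAtlas p)).contDiffAt
      (c.open_target.mem_nhds (c.map_source (mem_chart_source _ p)))).differentiableAt (by simp)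
  have hsum : fderiv ℝ ((fun q => ∑ i ∈ s, Z i q) ∘ c.symm) (c p) =
      ∑ i ∈ s, fderiv ℝ (Z i ∘ c.symm) (c p) := fderiv_fun_sum hd
  simp only [surfaceDivergence, ← hcdef, paramDivergence]
  rw [hsum]
  simp only [sum_apply, sum_inner, Finset.mul_sum]
  rw [Finset.sum_comm (s := s)]
  exact Finset.sum_congr rfl fun i _ => Finset.sum_comm

lemma continuous_surfaceDivergence_add_inner (hF : IsImmersion (𝓡 2) (𝓡 n) ∞ F)
    (hY : ContMDiff (𝓡 2) (𝓡 n) 1 Y) :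
    Continuous fun q => surfaceDivergence F Y q + inner ℝ (Y q) (meanCurvatureVector F q) :=
  (continuous_surfaceDivergence hF hY).add
    (hY.continuous.inner (continuous_meanCurvatureVector hF))

variable [CompactSpace M] [MeasurableSpace M] [BorelSpace M]

lemma integrable_areaMeasure (hF : ContMDiff (𝓡 2) (𝓡 n) ∞ F) {h : M → ℝ} (hh : Continuous h) :
    Integrable h (areaMeasure F) := by
  have := isLocallyFiniteMeasure_areaMeasure hF
  exact hh.integrable_of_hasCompactSupport (HasCompactSupport.of_compactSpace h)

/-- The integrand vanishes off the chart domain, and the chart carries the support of `Y` to a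
compact set, so the formula in the parameter domain applies. -/
lemma integral_surfaceDivergence_add_inner_eq_zero_of_tsupport_subset
    (hF : IsImmersion (𝓡 2) (𝓡 n) ∞ F) (hY : ContMDiff (𝓡 2) (𝓡 n) 1 Y)
    {e : OpenPartialHomeomorph M (EuclideanSpace ℝ (Fin 2))}
    (he : e ∈ atlas (EuclideanSpace ℝ (Fin 2)) M) (hYe : tsupport Y ⊆ e.source) :
    ∫ q, (surfaceDivergence F Y q + inner ℝ (Y q) (meanCurvatureVector F q)) ∂(areaMeasure F)
      = 0 := by
  have hem : e ∈ IsManifold.maximalAtlas (𝓡 2) ∞ M := IsManifold.subset_maximalAtlas he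
  have hzero : ∀ q, q ∉ e.source →
      surfaceDivergence F Y q + inner ℝ (Y q) (meanCurvatureVector F q) = 0 := fun q hq => by
    have hq' : q ∉ tsupport Y := fun h => hq (hYe h)
    rw [surfaceDivergence_eq_zero_of_notMem_tsupport hq', image_eq_zero_of_notMem_tsupport hq',
      inner_zero_left, add_zero]
  rw [← setIntegral_eq_integral_of_forall_compl_eq_zero hzero,
    setIntegral_source_areaMeasure hF.contMDiff he (continuous_surfaceDivergence_add_inner hF hY)]
  have hK : IsCompact (e '' tsupport Y) :=
    (isClosed_tsupport Y).isCompact.image_of_continuousOn (e.continuousOn.mono hYe)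
  rw [← setIntegral_divergence_add_inner_eq_zero e.open_target
    (contDiffOn_comp_symm (m := ⊤) hF.contMDiff hem)
    (fun x hx => injective_fderiv_comp_symm hF hem hx) (contDiffOn_comp_symm (m := 1) hY hem) hK
    (by rintro _ ⟨q, hq, rfl⟩; exact e.map_source (hYe hq)) fun x hx hxK =>
      show Y (e.symm x) = 0 from
        image_eq_zero_of_notMem_tsupport fun h => hxK ⟨_, h, e.right_inv hx⟩]
  refine setIntegral_congr_fun e.open_target.measurableSet fun x hx => ?_
  have hs := e.map_target hx
  simp only [surfaceDivergence_eq hF.contMDiff hY hem hs, meanCurvatureVector_eq hF.contMDiff hem hs,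
    e.right_inv hx, Function.comp_apply]

/-- The first variation formula on a closed surface. -/
lemma integral_surfaceDivergence_add_inner_eq_zero [T2Space M]
    (hF : IsImmersion (𝓡 2) (𝓡 n) ∞ F) (hY : ContMDiff (𝓡 2) (𝓡 n) 1 Y) :
    ∫ q, (surfaceDivergence F Y q + inner ℝ (Y q) (meanCurvatureVector F q)) ∂(areaMeasure F)
      = 0 := by
  -- Each `ρ i • Y` is itself an admissible field and the integrand is additive in the field, so
  -- derivatives of `ρ i` never appear. By compactness only finitely many are nonzero.
  obtain ⟨ρ, hρ⟩ := SmoothPartitionOfUnity.exists_isSubordinate_chartAt_source (𝓡 2) M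
  have hfin := ρ.locallyFinite.finite_nonempty_of_compact
  set s := hfin.toFinset
  set Z : M → M → EuclideanSpace ℝ (Fin n) := fun i q => ρ i q • Y q with hZdef
  have hZ : ∀ i, ContMDiff (𝓡 2) (𝓡 n) 1 (Z i) := fun i =>
    ((ρ i).contMDiff.of_le (by norm_cast)).smul hY
  have hsum : Y = fun q => ∑ i ∈ s, Z i q := by
    funext q
    rw [hZdef, ← Finset.sum_smul]
    have h1 := ρ.sum_eq_one (mem_univ q)
    rw [finsum_eq_sum_of_support_subset (s := s) _ fun i hi => by
      rw [Finite.coe_toFinset]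
      exact ⟨q, hi⟩] at h1
    rw [h1, one_smul]
  have hL : ∀ q, surfaceDivergence F Y q + inner ℝ (Y q) (meanCurvatureVector F q) =
      ∑ i ∈ s, (surfaceDivergence F (Z i) q + inner ℝ (Z i q) (meanCurvatureVector F q)) := by
    intro q
    rw [Finset.sum_add_distrib, ← sum_inner, ← surfaceDivergence_sum s fun i _ => hZ i, ← hsum]
    congr 2
    exact congrFun hsum q
  simp only [hL]
  rw [integral_finsetSum _ fun i _ => integrable_areaMeasure hF.contMDiff
    (continuous_surfaceDivergence_add_inner hF (hZ i))]
  refine Finset.sum_eq_zero fun i _ => ?_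
  refine integral_surfaceDivergence_add_inner_eq_zero_of_tsupport_subset hF (hZ i)
    (chart_mem_atlas _ i) ((closure_mono ?_).trans (hρ i))
  exact fun q hq h0 => hq (by simp [hZdef, h0])

end FirstVariation

/-! ### Radial vector fields -/

lemma hasDerivAt_sq_max_zero (u : ℝ) : HasDerivAt (fun u : ℝ => max u 0 ^ 2) (2 * max u 0) u := by
  rcases lt_trichotomy u 0 with hu | rfl | hu
  · rw [max_eq_right hu.le, mul_zero]
    refine (hasDerivAt_const u (0 : ℝ)).congr_of_eventuallyEq ?_
    filter_upwards [Iio_mem_nhds hu] with v hv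
    rw [max_eq_right (le_of_lt hv)]
    norm_num
  · rw [max_self, mul_zero, hasDerivAt_iff_isLittleO]
    simp only [max_self, sub_zero, smul_zero, ne_eq, OfNat.ofNat_ne_zero, not_false_eq_true,
      zero_pow]
    refine Asymptotics.IsBigO.trans_isLittleO ?_ (Asymptotics.isLittleO_pow_id one_lt_two)
    refine Asymptotics.IsBigO.of_bound 1 (Eventually.of_forall fun v => ?_)
    rw [one_mul, Real.norm_of_nonneg (sq_nonneg _), Real.norm_of_nonneg (sq_nonneg _)]
    rcases le_total v 0 with h | h
    · rw [max_eq_right h]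
      nlinarith
    · rw [max_eq_left h]
  · rw [max_eq_left hu.le]
    have h := hasDerivAt_pow 2 u
    simp only [Nat.cast_ofNat, Nat.add_one_sub_one, pow_one] at h
    refine h.congr_of_eventuallyEq ?_
    filter_upwards [Ioi_mem_nhds hu] with v hv
    rw [max_eq_left (le_of_lt hv)]

/-- A `C¹` convex function of slope between `0` and `1`, constant for `s ≤ c` and equal to `s` for
`s ≥ c + δ`. -/
noncomputable def smoothMax (c δ s : ℝ) : ℝ :=
  c + δ / 2 + (max (s - c) 0 ^ 2 - max (s - c - δ) 0 ^ 2) / (2 * δ)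

/-- The derivative of `smoothMax`. -/
noncomputable def smoothMaxSlope (c δ s : ℝ) : ℝ := (max (s - c) 0 - max (s - c - δ) 0) / δ

section SmoothMax

variable {c δ : ℝ} (hδ : 0 < δ) (s : ℝ)

include hδ

lemma hasDerivAt_smoothMax : HasDerivAt (smoothMax c δ) (smoothMaxSlope c δ s) s := by
  have h1 := (hasDerivAt_sq_max_zero (s - c)).comp s ((hasDerivAt_id s).sub_const c)
  have h2 := (hasDerivAt_sq_max_zero (s - c - δ)).comp s
    (((hasDerivAt_id s).sub_const c).sub_const δ)
  refine (((h1.sub h2).div_const (2 * δ)).const_add (c + δ / 2)).congr_deriv ?_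
  rw [smoothMaxSlope]
  field_simp

lemma smoothMaxSlope_nonneg : 0 ≤ smoothMaxSlope c δ s :=
  div_nonneg (sub_nonneg.2 (max_le_max (by linarith) le_rfl)) hδ.le

lemma smoothMaxSlope_le_one : smoothMaxSlope c δ s ≤ 1 := by
  rw [smoothMaxSlope, div_le_one hδ]
  rcases le_total (s - c - δ) 0 with h | h
  · rw [max_eq_right h, sub_zero]
    exact max_le (by linarith) hδ.le
  · rw [max_eq_left h, max_eq_left (by linarith)]
    linarith

lemma smoothMaxSlope_eq_one (h : c + δ ≤ s) : smoothMaxSlope c δ s = 1 := by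
  rw [smoothMaxSlope, max_eq_left (by linarith), max_eq_left (by linarith)]
  field_simp
  ring

lemma smoothMaxSlope_eq_zero (h : s ≤ c) : smoothMaxSlope c δ s = 0 := by
  rw [smoothMaxSlope, max_eq_right (by linarith), max_eq_right (by linarith)]
  simp

lemma smoothMax_eq (h : s ≤ c) : smoothMax c δ s = c + δ / 2 := by
  rw [smoothMax, max_eq_right (by linarith), max_eq_right (by linarith)]
  simp

lemma le_smoothMax : s ≤ smoothMax c δ s := by
  rcases le_total s c with h | h
  · rw [smoothMax_eq hδ s h]
    linarith
  · rw [smoothMax, max_eq_left (by linarith : 0 ≤ s - c)]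
    rcases le_total (s - c - δ) 0 with h' | h'
    · rw [max_eq_right h']
      have : s - c - δ / 2 ≤ ((s - c) ^ 2 - 0 ^ 2) / (2 * δ) := by
        rw [le_div_iff₀ (by positivity)]
        nlinarith [sq_nonneg (s - c - δ)]
      linarith
    · rw [max_eq_left h']
      apply le_of_eq
      field_simp
      ring

lemma smoothMax_pos (hc : 0 ≤ c) : 0 < smoothMax c δ s := by
  have h : 0 ≤ (max (s - c) 0 ^ 2 - max (s - c - δ) 0 ^ 2) / (2 * δ) := by
    refine div_nonneg (sub_nonneg.2 (pow_le_pow_left₀ (le_max_right _ _) ?_ 2)) (by positivity)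
    exact max_le_max (by linarith) le_rfl
  rw [smoothMax]
  positivity

/-- Makes the main term of the radial inequality nonnegative everywhere, so its integral over a ball
is at most its integral over the surface. -/
lemma smoothMax_sub_mul_slope_nonneg (hc : 0 ≤ c) :
    0 ≤ smoothMax c δ s - s * smoothMaxSlope c δ s := by
  have h0 := smoothMaxSlope_nonneg hδ s (c := c)
  have h1 := smoothMaxSlope_le_one hδ s (c := c)
  have h2 := le_smoothMax hδ s (c := c)
  have h3 := smoothMax_pos hδ s hc
  rcases le_total s 0 with h | h <;> nlinarith

end SmoothMax

lemma continuous_smoothMaxSlope (c δ : ℝ) : Continuous (smoothMaxSlope c δ) := by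
  unfold smoothMaxSlope
  fun_prop

lemma contDiff_smoothMax {c δ : ℝ} (hδ : 0 < δ) : ContDiff ℝ 1 (smoothMax c δ) := by
  rw [contDiff_one_iff_deriv]
  refine ⟨fun s => (hasDerivAt_smoothMax hδ s).differentiableAt, ?_⟩
  rw [show deriv (smoothMax c δ) = smoothMaxSlope c δ from
    funext fun s => (hasDerivAt_smoothMax hδ s).deriv]
  exact continuous_smoothMaxSlope c δ

/-- The vector field `(v - x₀) / ψ(|v - x₀|²)` with `ψ = smoothMax c δ`. -/
noncomputable def radialField {n : ℕ} (c δ : ℝ) (x₀ v : EuclideanSpace ℝ (Fin n)) :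
    EuclideanSpace ℝ (Fin n) :=
  (smoothMax c δ (‖v - x₀‖ ^ 2))⁻¹ • (v - x₀)

section Radial

variable {n : ℕ} {c δ : ℝ} {x₀ : EuclideanSpace ℝ (Fin n)}

lemma contDiff_radialField (hc : 0 ≤ c) (hδ : 0 < δ) : ContDiff ℝ 1 (radialField c δ x₀) := by
  have h : ContDiff ℝ 1 fun v : EuclideanSpace ℝ (Fin n) => v - x₀ :=
    contDiff_id.sub contDiff_const
  exact (((contDiff_smoothMax hδ).comp (h.norm_sq ℝ)).inv fun v =>
    (smoothMax_pos hδ _ hc).ne').smul h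

lemma fderiv_radialField (hc : 0 ≤ c) (hδ : 0 < δ) (v w : EuclideanSpace ℝ (Fin n)) :
    fderiv ℝ (radialField c δ x₀) v w =
      (smoothMax c δ (‖v - x₀‖ ^ 2))⁻¹ • w -
        (2 * smoothMaxSlope c δ (‖v - x₀‖ ^ 2) * (smoothMax c δ (‖v - x₀‖ ^ 2))⁻¹ ^ 2 *
          inner ℝ w (v - x₀)) • (v - x₀) := by
  have hd : HasFDerivAt (fun v => v - x₀) (ContinuousLinearMap.id ℝ (EuclideanSpace ℝ (Fin n))) v :=
    (hasFDerivAt_id v).sub_const x₀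
  have h1 := ((hasDerivAt_inv (smoothMax_pos hδ (‖v - x₀‖ ^ 2) hc).ne').comp _
    (hasDerivAt_smoothMax hδ (‖v - x₀‖ ^ 2))).comp_hasFDerivAt v hd.norm_sq
  have h2 : HasFDerivAt (radialField c δ x₀) _ v := h1.smul hd
  rw [h2.fderiv]
  simp only [add_apply, smul_apply, ContinuousLinearMap.smulRight_apply, Function.comp_apply,
    ContinuousLinearMap.id_apply, ContinuousLinearMap.comp_apply, innerSL_apply_apply, smul_eq_mul,
    nsmul_eq_mul, Nat.cast_ofNat, real_inner_comm w]
  rw [sub_eq_add_neg ((_ : ℝ) • w), ← neg_smul, inv_pow]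
  congr 2
  ring

variable {f : EuclideanSpace ℝ (Fin 2) → EuclideanSpace ℝ (Fin n)}
  {x : EuclideanSpace ℝ (Fin 2)}

/-- The identity part of the derivative has trace `2` along the surface. The derivative of `ψ`
contributes the squared length of the tangential part of `f x - x₀`. -/
lemma paramDivergence_radialField (hc : 0 ≤ c) (hδ : 0 < δ) (hf : DifferentiableAt ℝ f x)
    (hinj : Function.Injective (fderiv ℝ f x)) :
    paramDivergence f (radialField c δ x₀ ∘ f) x =
      2 * (smoothMax c δ (‖f x - x₀‖ ^ 2))⁻¹ -
        2 * smoothMaxSlope c δ (‖f x - x₀‖ ^ 2) * (smoothMax c δ (‖f x - x₀‖ ^ 2))⁻¹ ^ 2 *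
          ∑ i, ∑ j, (firstFundamentalForm f x)⁻¹ i j *
            (inner ℝ (fderiv ℝ f x (coordVec i)) (f x - x₀) *
              inner ℝ (fderiv ℝ f x (coordVec j)) (f x - x₀)) := by
  have hdet := (det_firstFundamentalForm_pos hinj).ne'
  have htr : ∑ i, ∑ j, (firstFundamentalForm f x)⁻¹ i j *
      inner ℝ (fderiv ℝ f x (coordVec i)) (fderiv ℝ f x (coordVec j)) = 2 := by
    have h := congrArg Matrix.trace (Matrix.nonsing_inv_mul _ hdet.isUnit)
    rw [Matrix.trace_one, Fintype.card_fin, Matrix.trace] at h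
    simp only [Matrix.diag_apply, Matrix.mul_apply] at h
    rw [← Nat.cast_ofNat (R := ℝ), ← h]
    exact Finset.sum_congr rfl fun i _ => Finset.sum_congr rfl fun j _ => by
      rw [firstFundamentalForm_comm j i]
      rfl
  have hd := (contDiff_radialField (x₀ := x₀) hc hδ).differentiable (by norm_num) (f x)
  have hkey : 2 * (smoothMax c δ (‖f x - x₀‖ ^ 2))⁻¹ = (smoothMax c δ (‖f x - x₀‖ ^ 2))⁻¹ *
      ∑ i, ∑ j, (firstFundamentalForm f x)⁻¹ i j *
        inner ℝ (fderiv ℝ f x (coordVec i)) (fderiv ℝ f x (coordVec j)) := by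
    rw [htr, mul_comm]
  rw [hkey, paramDivergence]
  simp only [fderiv_comp x hd hf, ContinuousLinearMap.comp_apply, fderiv_radialField hc hδ,
    inner_sub_left, real_inner_smul_left, Finset.mul_sum, ← Finset.sum_sub_distrib,
    real_inner_comm (fderiv ℝ f x _) (f x - x₀)]
  exact Finset.sum_congr rfl fun i _ => Finset.sum_congr rfl fun j _ => by ring

/-- Here `s = |v|²`, `t = ψ'(s)`, `Q = |v^⊤|²`, `h = ⟨v, H⟩`, `a = |H|`. With `k = 1/ψ`, the
difference of the sides is `t` times `2(s-Q)k² + hk + a²/8`, plus `1-t` times `ηsk² + hk + a²/(4η)`,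
plus `η(ψ-s)k²`. Both quadratics are nonnegative by their discriminants: the first uses the normal
part of `v`, the second plain Cauchy–Schwarz. -/
lemma radial_inequality {ψ s t Q h a η : ℝ} (hψ : 0 < ψ) (hsψ : s ≤ ψ) (hs : 0 ≤ s) (ht0 : 0 ≤ t)
    (ht1 : t ≤ 1) (hη : 0 < η) (hQ : 0 ≤ s - Q) (hh : h ^ 2 ≤ (s - Q) * a ^ 2)
    (hh' : h ^ 2 ≤ s * a ^ 2) :
    (2 - η) * ((ψ - s * t) * ψ⁻¹ ^ 2) - t * (a ^ 2 / 8) - (1 - t) * (a ^ 2 / (4 * η)) ≤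
      2 * ψ⁻¹ - 2 * t * ψ⁻¹ ^ 2 * Q + ψ⁻¹ * h := by
  obtain ⟨k, hk⟩ : ∃ k, k = ψ⁻¹ := ⟨_, rfl⟩
  have hk0 : 0 < k := hk ▸ inv_pos.2 hψ
  have hψk : ψ * k = 1 := hk ▸ mul_inv_cancel₀ hψ.ne'
  rw [← hk]
  have h1 : 0 ≤ 2 * (s - Q) * k ^ 2 + h * k + a ^ 2 / 8 := by
    have := neg_le_of_abs_le (abs_le_of_sq_le_sq (a := h * k)
      (b := 2 * (s - Q) * k ^ 2 + a ^ 2 / 8) (by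
        nlinarith [sq_nonneg (2 * (s - Q) * k ^ 2 - a ^ 2 / 8),
          mul_le_mul_of_nonneg_right hh (sq_nonneg k)]) (by positivity))
    linarith
  have h2 : 0 ≤ η * s * k ^ 2 + h * k + a ^ 2 / (4 * η) := by
    have hη' : η * (a ^ 2 / (4 * η)) = a ^ 2 / 4 := by field_simp
    have hb : 0 ≤ a ^ 2 / (4 * η) := by positivity
    generalize a ^ 2 / (4 * η) = b at hη' hb
    have := neg_le_of_abs_le (abs_le_of_sq_le_sq (a := h * k) (b := η * s * k ^ 2 + b) (by
        have e : (η * s * k ^ 2 + b) ^ 2 = (η * s * k ^ 2 - b) ^ 2 + s * a ^ 2 * k ^ 2 := by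
          linear_combination 4 * s * k ^ 2 * hη'
        rw [e]
        nlinarith [sq_nonneg (η * s * k ^ 2 - b),
          mul_le_mul_of_nonneg_right hh' (sq_nonneg k)]) (by positivity))
    linarith
  have h3 : 0 ≤ η * (ψ - s) * k ^ 2 :=
    mul_nonneg (mul_nonneg hη.le (sub_nonneg.2 hsψ)) (sq_nonneg k)
  have e : 2 * k = 2 * (ψ * k) * k := by rw [hψk, mul_one]
  rw [e]
  linear_combination mul_nonneg ht0 h1 + mul_nonneg (sub_nonneg.2 ht1) h2 + h3

/-- Lower bound for the integrand of the first variation of a radial field. -/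
lemma le_paramDivergence_radialField_add_inner (hc : 0 ≤ c) (hδ : 0 < δ) {η : ℝ} (hη : 0 < η)
    (hf : DifferentiableAt ℝ f x) (hinj : Function.Injective (fderiv ℝ f x)) :
    (2 - η) * ((smoothMax c δ (‖f x - x₀‖ ^ 2) -
        ‖f x - x₀‖ ^ 2 * smoothMaxSlope c δ (‖f x - x₀‖ ^ 2)) *
          (smoothMax c δ (‖f x - x₀‖ ^ 2))⁻¹ ^ 2) -
      smoothMaxSlope c δ (‖f x - x₀‖ ^ 2) * (‖paramMeanCurvature f x‖ ^ 2 / 8) -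
      (1 - smoothMaxSlope c δ (‖f x - x₀‖ ^ 2)) * (‖paramMeanCurvature f x‖ ^ 2 / (4 * η)) ≤
    paramDivergence f (radialField c δ x₀ ∘ f) x +
      inner ℝ (radialField c δ x₀ (f x)) (paramMeanCurvature f x) := by
  obtain ⟨τ, hτ, hvτ, hττ⟩ := exists_tangential_part hinj (f x - x₀)
  rw [paramDivergence_radialField hc hδ hf hinj, ← hvτ, radialField, real_inner_smul_left]
  have hsub : ‖f x - x₀ - τ‖ ^ 2 = ‖f x - x₀‖ ^ 2 - inner ℝ (f x - x₀) τ := by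
    rw [norm_sub_sq_real, ← real_inner_self_eq_norm_sq τ, hττ]
    ring
  have hcs : ∀ u w : EuclideanSpace ℝ (Fin n), inner ℝ u w ^ 2 ≤ ‖u‖ ^ 2 * ‖w‖ ^ 2 := fun u w => by
    rw [← mul_pow, ← sq_abs]
    exact pow_le_pow_left₀ (abs_nonneg _) (abs_real_inner_le_norm u w) 2
  refine radial_inequality (smoothMax_pos hδ _ hc) (le_smoothMax hδ _) (sq_nonneg _)
    (smoothMaxSlope_nonneg hδ _) (smoothMaxSlope_le_one hδ _) hη (hsub ▸ sq_nonneg _) ?_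
    (hcs _ _)
  rw [← hsub]
  -- As `H` is normal, only the normal part of the position contributes; this yields the sharp
  -- constant `1/8`.
  have hperp : inner ℝ (f x - x₀) (paramMeanCurvature f x) =
      inner ℝ (f x - x₀ - τ) (paramMeanCurvature f x) := by
    rw [inner_sub_left _ τ, inner_paramMeanCurvature_eq_zero hτ, sub_zero]
  rw [hperp]
  exact hcs _ _

end Radial

/-! ### Area ratios and the non-concentration radius -/

section AreaRatio

variable {n : ℕ} {M : Type*} [TopologicalSpace M] [ChartedSpace (EuclideanSpace ℝ (Fin 2)) M]
  [IsManifold (𝓡 2) ∞ M] [CompactSpace M] [MeasurableSpace M] [BorelSpace M]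
  {F : M → EuclideanSpace ℝ (Fin n)}

lemma willmoreEnergyOn_eq_ofReal (hF : IsImmersion (𝓡 2) (𝓡 n) ∞ F) (S : Set M) :
    willmoreEnergyOn F S =
      ENNReal.ofReal (∫ q in S, ‖meanCurvatureVector F q‖ ^ 2 ∂(areaMeasure F)) := by
  have hi : Integrable (fun q => ‖meanCurvatureVector F q‖ ^ 2) (areaMeasure F) :=
    integrable_areaMeasure hF.contMDiff ((continuous_meanCurvatureVector hF).norm.pow 2)
  rw [ofReal_integral_eq_lintegral_ofReal hi.integrableOn
    (Eventually.of_forall fun q => sq_nonneg _), willmoreEnergyOn]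
  refine lintegral_congr fun q => ?_
  rw [← ofReal_norm, ENNReal.ofReal_pow (norm_nonneg _)]

/-- Localized Li–Yau type bound for the area of a closed surface in a ball. -/
lemma measureReal_preimage_ball_le [T2Space M] (hF : IsImmersion (𝓡 2) (𝓡 n) ∞ F)
    (x₀ : EuclideanSpace ℝ (Fin n)) {r R η : ℝ} (hr : 0 < r) (hη : 0 < η) (hη2 : η ≤ 2)
    (hR : 0 ≤ R) (hrR : (1 + η) * r ^ 2 ≤ R ^ 2) :
    (2 - η) * (areaMeasure F).real (F ⁻¹' Metric.ball x₀ r) ≤ (1 + η) * r ^ 2 *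
      ((∫ q, ‖meanCurvatureVector F q‖ ^ 2 ∂(areaMeasure F)) / 8 +
        (∫ q in F ⁻¹' Metric.ball x₀ R, ‖meanCurvatureVector F q‖ ^ 2 ∂(areaMeasure F)) /
          (4 * η)) := by
  have hFc : Continuous F := hF.contMDiff.continuous
  have hHc : Continuous fun q => ‖meanCurvatureVector F q‖ ^ 2 :=
    (continuous_meanCurvatureVector hF).norm.pow 2
  have hc : 0 ≤ r ^ 2 := sq_nonneg r
  -- The transition layer is `r² ≤ s ≤ (1+η)r²`, which `hrR` keeps below `R²`.
  have hδ : 0 < η * r ^ 2 := by positivity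
  have := isLocallyFiniteMeasure_areaMeasure hF.contMDiff
  set μ := areaMeasure F
  have hI : ∀ {h : M → ℝ}, Continuous h → Integrable h μ := integrable_areaMeasure hF.contMDiff
  set ψ := fun q => smoothMax (r ^ 2) (η * r ^ 2) (‖F q - x₀‖ ^ 2)
  set t := fun q => smoothMaxSlope (r ^ 2) (η * r ^ 2) (‖F q - x₀‖ ^ 2)
  have hs : Continuous fun q => ‖F q - x₀‖ ^ 2 := (hFc.sub continuous_const).norm.pow 2
  have hψc : Continuous ψ := (contDiff_smoothMax hδ).continuous.comp hs
  have htc : Continuous t := (continuous_smoothMaxSlope _ _).comp hs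
  have hψ0 : ∀ q, ψ q ≠ 0 := fun q => (smoothMax_pos hδ _ hc).ne'
  set Y := fun q => radialField (r ^ 2) (η * r ^ 2) x₀ (F q)
  have hYs : ContMDiff (𝓡 2) (𝓡 n) 1 Y :=
    (contDiff_radialField hc hδ).contMDiff.comp (hF.contMDiff.of_le (by norm_cast))
  have hpt : ∀ q, (2 - η) * ((ψ q - ‖F q - x₀‖ ^ 2 * t q) * (ψ q)⁻¹ ^ 2) -
      t q * (‖meanCurvatureVector F q‖ ^ 2 / 8) -
      (1 - t q) * (‖meanCurvatureVector F q‖ ^ 2 / (4 * η)) ≤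
      surfaceDivergence F Y q + inner ℝ (Y q) (meanCurvatureVector F q) := by
    intro q
    set c := chartAt (EuclideanSpace ℝ (Fin 2)) q with hcdef
    have hcm : c ∈ IsManifold.maximalAtlas (𝓡 2) ∞ M := IsManifold.chart_mem_maximalAtlas q
    have hqc : q ∈ c.source := mem_chart_source _ q
    have hx := c.map_source hqc
    have h := le_paramDivergence_radialField_add_inner (x₀ := x₀) hc hδ hη
      (((contDiffOn_comp_symm (m := ⊤) hF.contMDiff hcm).contDiffAt
        (c.open_target.mem_nhds hx)).differentiableAt (by simp))
      (injective_fderiv_comp_symm hF hcm hx)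
    simp only [Function.comp_apply, c.left_inv hqc] at h
    exact h
  set A := fun q => (ψ q - ‖F q - x₀‖ ^ 2 * t q) * (ψ q)⁻¹ ^ 2 with hA
  have hAc : Continuous A := (hψc.sub (hs.mul htc)).mul ((hψc.inv₀ hψ0).pow 2)
  have hA0 : ∀ q, 0 ≤ A q := fun q =>
    mul_nonneg (smoothMax_sub_mul_slope_nonneg hδ _ hc) (sq_nonneg _)
  set B := F ⁻¹' Metric.ball x₀ r with hB
  have hBm : MeasurableSet B := (Metric.isOpen_ball.preimage hFc).measurableSet
  set D := F ⁻¹' Metric.ball x₀ R with hD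
  have hDm : MeasurableSet D := (Metric.isOpen_ball.preimage hFc).measurableSet
  -- Integrate the pointwise bound. The `1/(4η)` term carries the factor `1 - t`, which vanishes
  -- outside `D`.
  have h1 : ∫ q, (2 - η) * A q ∂μ ≤ ∫ q, ‖meanCurvatureVector F q‖ ^ 2 / 8 ∂μ +
      ∫ q in D, ‖meanCurvatureVector F q‖ ^ 2 / (4 * η) ∂μ := by
    have hi8 : Integrable (fun q => ‖meanCurvatureVector F q‖ ^ 2 / 8) μ := hI (hHc.div_const _)
    have hi4 : Integrable (D.indicator fun q => ‖meanCurvatureVector F q‖ ^ 2 / (4 * η)) μ :=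
      (hI (hHc.div_const _)).indicator hDm
    have hi84 : Integrable (fun q => ‖meanCurvatureVector F q‖ ^ 2 / 8 +
      D.indicator (fun q => ‖meanCurvatureVector F q‖ ^ 2 / (4 * η)) q) μ := hi8.add hi4
    have hiL := hI (continuous_surfaceDivergence_add_inner hF hYs)
    rw [← integral_indicator hDm, ← integral_add hi8 hi4, ← zero_add (∫ q, _ + _ ∂μ),
      ← integral_surfaceDivergence_add_inner_eq_zero hF hYs, ← integral_add hiL hi84]
    refine integral_mono (hI (continuous_const.mul hAc)) (hiL.add hi84) fun q => ?_
    have hq' := hpt q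
    have ht0 : 0 ≤ t q := smoothMaxSlope_nonneg hδ _
    have ht1 : t q ≤ 1 := smoothMaxSlope_le_one hδ _
    have ha : 0 ≤ ‖meanCurvatureVector F q‖ ^ 2 / 8 := by positivity
    have hb : 0 ≤ ‖meanCurvatureVector F q‖ ^ 2 / (4 * η) := by positivity
    have hta : t q * (‖meanCurvatureVector F q‖ ^ 2 / 8) ≤ ‖meanCurvatureVector F q‖ ^ 2 / 8 :=
      mul_le_of_le_one_left ha ht1
    have htb : (1 - t q) * (‖meanCurvatureVector F q‖ ^ 2 / (4 * η)) ≤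
        D.indicator (fun q => ‖meanCurvatureVector F q‖ ^ 2 / (4 * η)) q := by
      by_cases hq : q ∈ D
      · rw [indicator_of_mem hq]
        exact mul_le_of_le_one_left hb (by linarith)
      · rw [indicator_of_notMem hq]
        have hRq : R ≤ ‖F q - x₀‖ := by
          simpa [hD, Metric.mem_ball, dist_eq_norm] using hq
        have : t q = 1 := smoothMaxSlope_eq_one hδ _
          (by nlinarith [pow_le_pow_left₀ hR hRq 2])
        rw [this, sub_self, zero_mul]
    simp only
    linarith
  -- On `B` the slope is `0` and `ψ = (1+η/2)r²`, so `A = 1/ψ` there.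
  have h2 : μ.real B * ((1 + η) * r ^ 2)⁻¹ ≤ ∫ q, A q ∂μ := by
    have hle : ∫ q in B, ((1 + η) * r ^ 2)⁻¹ ∂μ ≤ ∫ q in B, A q ∂μ := by
      refine setIntegral_mono_on (integrableOn_const (hs := measure_ne_top_of_subset
        (subset_univ B) isCompact_univ.measure_lt_top.ne)) (hI hAc).integrableOn hBm
        fun q hq => ?_
      have hqr : ‖F q - x₀‖ ≤ r := by
        have := hq
        simp only [hB, mem_preimage, Metric.mem_ball, dist_eq_norm] at this
        exact this.le
      have hq2 : ‖F q - x₀‖ ^ 2 ≤ r ^ 2 := pow_le_pow_left₀ (norm_nonneg _) hqr 2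
      have e1 : ψ q = r ^ 2 + η * r ^ 2 / 2 := smoothMax_eq hδ _ hq2
      have e2 : t q = 0 := smoothMaxSlope_eq_zero hδ _ hq2
      have e3 : A q = (ψ q)⁻¹ := by
        simp only [hA, e2, mul_zero, sub_zero]
        field_simp [hψ0 q]
      rw [e3, e1]
      exact inv_anti₀ (by positivity) (by nlinarith)
    rw [setIntegral_const, smul_eq_mul] at hle
    exact hle.trans (setIntegral_le_integral (hI hAc) (Eventually.of_forall hA0))
  rw [integral_const_mul, integral_div, integral_div] at h1
  have h3 := mul_le_mul_of_nonneg_left h2 (sub_nonneg.2 hη2)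
  have h4 := h3.trans h1
  rw [← mul_assoc, ← div_eq_mul_inv, div_le_iff₀ (by positivity)] at h4
  linarith

end AreaRatio

lemma areaMeasure_preimage_ball_div_le {n : ℕ} {M : Type*} [TopologicalSpace M] [T2Space M]
    [CompactSpace M] [ChartedSpace (EuclideanSpace ℝ (Fin 2)) M] [IsManifold (𝓡 2) ∞ M]
    [MeasurableSpace M] [BorelSpace M] {F : M → EuclideanSpace ℝ (Fin n)}
    (hF : IsImmersion (𝓡 2) (𝓡 n) ∞ F) (x₀ : EuclideanSpace ℝ (Fin n)) {α γ r R : ℝ}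
    (hγ : 0 < γ) (hγα : γ < α) (hα : α < 1) (hr : 0 < r) (hrR : 2 * r ≤ R)
    (hW : willmoreEnergyOn F univ ≤ ENNReal.ofReal (32 * Real.pi * (1 - α)))
    (hWR : willmoreEnergyOn F (F ⁻¹' Metric.ball x₀ R) ≤
      ENNReal.ofReal (Real.pi * (α - γ) ^ 2)) :
    areaMeasure F (F ⁻¹' Metric.ball x₀ r) / ENNReal.ofReal (Real.pi * r ^ 2) ≤
      ENNReal.ofReal (2 * (1 - γ)) := by
  have := isLocallyFiniteMeasure_areaMeasure hF.contMDiff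
  have hπ := Real.pi_pos
  -- With this choice the energy in `B_R` is at most `4πη²`, so its contribution after division by
  -- `4η` is at most `πη`.
  obtain ⟨η, hη⟩ : ∃ η, η = (α - γ) / 2 := ⟨_, rfl⟩
  have hη0 : 0 < η := by linarith
  have h := measureReal_preimage_ball_le hF x₀ hr hη0 (by linarith) (by linarith : 0 ≤ R)
    (by nlinarith [pow_le_pow_left₀ (by positivity) hrR 2, sq_nonneg r])
  rw [willmoreEnergyOn_eq_ofReal hF, ENNReal.ofReal_le_ofReal_iff (by positivity)] at hWR
  rw [willmoreEnergyOn_eq_ofReal hF, setIntegral_univ,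
    ENNReal.ofReal_le_ofReal_iff (mul_nonneg (by positivity) (by linarith))] at hW
  have hαγ : α - γ = 2 * η := by linarith
  rw [hαγ] at hWR
  have hb : (∫ q in F ⁻¹' Metric.ball x₀ R, ‖meanCurvatureVector F q‖ ^ 2 ∂(areaMeasure F)) /
      (4 * η) ≤ Real.pi * η := by
    rw [div_le_iff₀ (by positivity)]
    linarith
  have hreal : (areaMeasure F).real (F ⁻¹' Metric.ball x₀ r) ≤
      2 * (1 - γ) * (Real.pi * r ^ 2) := by
    have h2 : 0 < 2 - η := by linarith
    refine le_of_mul_le_mul_left (h.trans ?_) h2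
    have h3 : (1 + η) * r ^ 2 * (Real.pi * (4 * (1 - α) + η)) ≤
        (2 - η) * (2 * (1 - γ) * (Real.pi * r ^ 2)) := by
      -- As `γ = α - 2η`, right side minus left side is `η(1 + 6α - 5η)`, positive because `α > 2η`.
      have h4 : (1 + η) * (4 * (1 - α) + η) ≤ (2 - η) * (2 * (1 - γ)) := by
        have : γ = α - 2 * η := by linarith
        subst this
        nlinarith [mul_pos hη0 hγ]
      nlinarith [mul_le_mul_of_nonneg_left h4 (by positivity : 0 ≤ Real.pi * r ^ 2)]
    refine (mul_le_mul_of_nonneg_left ?_ (by positivity)).trans h3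
    linarith
  have hfin : areaMeasure F (F ⁻¹' Metric.ball x₀ r) ≠ ⊤ :=
    measure_ne_top_of_subset (subset_univ _) isCompact_univ.measure_lt_top.ne
  rw [ENNReal.div_le_iff (by simpa using by positivity) ENNReal.ofReal_ne_top,
    ← ENNReal.ofReal_mul (by linarith), ← ENNReal.ofReal_toReal hfin]
  exact ENNReal.ofReal_le_ofReal hreal

theorem mainTheorem11 {n : ℕ} {α γ : ℝ} (hγ : 0 < γ) (hγα : γ < α) (hα : α < 1 / 2)
    (M : ℕ → Type*) [∀ i, TopologicalSpace (M i)] [∀ i, T2Space (M i)] [∀ i, CompactSpace (M i)]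
    [∀ i, ChartedSpace (EuclideanSpace ℝ (Fin 2)) (M i)] [∀ i, IsManifold (𝓡 2) ∞ (M i)]
    [∀ i, MeasurableSpace (M i)] [∀ i, BorelSpace (M i)]
    (F : ∀ i, M i → EuclideanSpace ℝ (Fin n))
    (hF : ∀ i, IsSmoothEmbedding (𝓡 2) (𝓡 n) ∞ (F i))
    (hW : ∀ i, willmoreEnergyOn (F i) univ ≤ ENNReal.ofReal (32 * Real.pi * (1 - α)))
    (hconc : Tendsto
      (fun r : ℝ => limsup
        (fun i => ⨆ p : M i, willmoreEnergyOn (F i) (F i ⁻¹' Metric.ball (F i p) r)) atTop)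
      (𝓝[>] 0) (𝓝 0)) :
    ∃ a : ℝ, 0 < a ∧ ∀ᶠ i in atTop, ENNReal.ofReal a ≤ nonConcentrationRadius γ (F i) := by
  have hε : 0 < ENNReal.ofReal (Real.pi * (α - γ) ^ 2) :=
    ENNReal.ofReal_pos.2 (mul_pos Real.pi_pos (pow_pos (sub_pos.2 hγα) 2))
  -- One radius whose limsup lies below the threshold `π(α-γ)²` of
  -- `areaMeasure_preimage_ball_div_le`; the supremum over `p` makes it uniform in the point.
  obtain ⟨R, hR, hR0⟩ :=
    ((hconc.eventually (gt_mem_nhds hε)).and (self_mem_nhdsWithin (s := Ioi (0 : ℝ)))).exists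
  refine ⟨R / 2, by linarith, ?_⟩
  filter_upwards [eventually_lt_of_limsup_lt hR] with i hi
  refine le_iInf₂ fun x hx => ?_
  obtain ⟨p, rfl⟩ := hx
  refine le_sSup ⟨R / 2, ⟨by linarith, fun r hr hrR => ?_⟩, rfl⟩
  exact areaMeasure_preimage_ball_div_le (hF i).isImmersion (F i p) hγ hγα (by linarith) hr
    (by linarith) (hW i) ((le_iSup (fun p : M i =>
      willmoreEnergyOn (F i) (F i ⁻¹' Metric.ball (F i p) R)) p).trans hi.le)
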